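/- **Proposition.** Let $K$ be a non-archimedean local field with its canonical absolute value $|\cdot|$ (the modulus of the additive Haar measure), ring of integers $O=\{|x|\le 1\}$, prime ideal $P=\{|x|<1\}$, uniformizer $\beta$ (so $P=\beta O$), $q=\#(O/P)$, and let $S\subset O$ be a complete set of representatives of $O/P$ with $0\in S$. Put $B_r=\beta^{-r}O$ for $r\in\mathbf Z$, and let $\chi$ be a continuous unitary character of $(K,+)$ of rank zero, i.e. $0$ is the largest integer $r$ with $\chi|_{B_r}\equiv 1$. Let $\alpha>0$ and $t>0$, and let $v:K\to[0,\infty)$ be continuous with $v(x)\to\infty$ as $|x|\to\infty$. For each integer $n\ge 1$ let $X_n=\{\sum_{i=-n}^{n-1}a_i\beta^i : a_i\in S\}$ and, for $s\ge 0$, $$p_{s,n}(x)=q^{-n}\sum_{\xi\in X_n}e^{-s|\xi|^\alpha}\chi(x\xi).$$ Let $D[0,t]$ be the space of functions $\omega:[0,t]\to K$ that are right-continuous with left limits and left-continuous at $t$, with the $\sigma$-algebra generated by the coordinate maps $\omega\mapsto\omega(s)$. For every $n\ge1$ and $a\in X_n$ there is a unique probability measure $\mathbf P^n_a$ on $D[0,t]$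 such that $$\mathbf P^n_a(\omega(t_i)\in J_i,\ 1\le i\le N)=\sum_{b_i\in J_i\cap X_n,\ 1\le i\le N}\ \prod_{i=1}^N p_{t_i-t_{i-1},n}(b_i-b_{i-1})\,q^{-n}\qquad(t_0=0,\ b_0=a)$$ for all $0\le t_1<\dots<t_N\le t$ and all Borel sets $J_1,\dots,J_N\subset K$. Let $\mathbf P^n_{a,b,t}$ denote $\mathbf P^n_a$ conditioned on the event $\omega(t)=b$, and set $$K^n_t(x,y)=p_{t,n}(y-x)\int_{D[0,t]}e^{-\int_0^t v(\omega(s))\,ds}\,d\mathbf P^n_{x,y,t}(\omega),\qquad x,y\in X_n .$$ Then for every real $k$ with $0<k<\alpha$ there is a constant $A_k>0$, independent of $n$ and $x$, such that for all $n\ge1$ and all $x\in X_n\setminus\{0\}$ $$K^n_t(x,x)\le A_k\left(e^{-\frac t2 v^*(x)}+\frac1{|x|^k}\right),\qquad v^*(x)=\inf_{|y|=|x|}v(y).$$ -/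

import Mathlib

open MeasureTheory Filter Topology Set

noncomputable section

namespace LocalFieldPropagator

section LocalField

variable (K : Type*) [NontriviallyNormedField K] [MeasurableSpace K]

/-- The norm of `K` is the canonical absolute value, i.e. the modulus of the additive Haar measure:
multiplication by `a` scales every Haar measure by the factor `‖a‖`. -/
def IsCanonicalAbs : Prop :=
  ∀ (μ : Measure K) [μ.IsAddHaarMeasure] (a : K) (E : Set K), MeasurableSet E →
    μ ((fun x => a * x) '' E) = ENNReal.ofReal ‖a‖ * μ E

variable {K}

/-- `β` generates the prime ideal `P = {x | ‖x‖ < 1}` of `O = {x | ‖x‖ ≤ 1}`. -/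
def IsUniformizer (β : K) : Prop :=
  {x : K | ‖x‖ < 1} = (fun y => β * y) '' {y : K | ‖y‖ ≤ 1}

/-- `S ⊆ O` is a complete set of representatives of the residue classes in `O / P`, in which the
zero class is represented by `0`. In particular `S.card` is the number `q` of elements
of `O / P`. -/
structure IsDigitSet (S : Finset K) : Prop where
  zero_mem : (0 : K) ∈ S
  norm_le_one : ∀ s ∈ S, ‖s‖ ≤ 1
  existsUnique_rep : ∀ x : K, ‖x‖ ≤ 1 → ∃! s, s ∈ S ∧ ‖x - s‖ < 1

/-- The ball `B_r = β⁻ʳ O`, `r ∈ ℤ`. -/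
def ball (β : K) (r : ℤ) : Set K := (fun y => β ^ (-r) * y) '' {y : K | ‖y‖ ≤ 1}

/-- A continuous unitary character of `(K, +)` of rank zero: `0` is the largest integer `r`
such that the character is trivial on `B_r`. -/
def IsRankZeroCharacter (β : K) (χ : AddChar K Circle) : Prop :=
  Continuous χ ∧ IsGreatest {r : ℤ | ∀ x ∈ ball β r, χ x = 1} 0

open Classical in
/-- The canonical set of representatives `X_n` of `G_n = B_n / B_{-n}`: all sums
`∑ a_i β^i`, `-n ≤ i ≤ n - 1`, with digits `a_i ∈ S`. -/
def grid (S : Finset K) (β : K) (n : ℕ) : Finset K :=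
  Finset.univ.image fun a : Fin (2 * n) → S => ∑ i, (a i : K) * β ^ ((i : ℤ) - (n : ℤ))

/-- The inverse finite Fourier transform
`(𝓕_n⁻¹ f)(x) = q⁻ⁿ ∑_{ξ ∈ X_n} f(ξ) χ(x ξ)`. -/
def finiteFourierInv (S : Finset K) (β : K) (χ : AddChar K Circle) (n : ℕ) (f : K → ℂ) (x : K) :
    ℂ :=
  ((S.card : ℂ) ^ n)⁻¹ * ∑ ξ ∈ grid S β n, f ξ * (χ (x * ξ) : ℂ)

/-- The density `p_{s,n} = 𝓕_n⁻¹ (e^{-s|·|^α})`. The transform is real-valued because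
`e^{-s|·|^α}` is even on the group `X_n`; `re` only changes the type. As a function on `B_n` it is
invariant under `B_{-n}`, so that differences of points of `X_n` may be taken in `K`. -/
def density (S : Finset K) (β : K) (χ : AddChar K Circle) (α : ℝ) (n : ℕ) (s : ℝ) (x : K) : ℝ :=
  (finiteFourierInv S β χ n (fun ξ => (Real.exp (-s * ‖ξ‖ ^ α) : ℂ)) x).re

end LocalField

section Paths

variable {K : Type*} [NontriviallyNormedField K]

/-- Skorokhod functions on `[0,t]`: right-continuous with left limits, and left-continuous at the
end point `t`. -/
structure IsSkorokhod {t : ℝ} (ω : Icc (0 : ℝ) t → K) : Prop where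
  right_cont : ∀ s, Tendsto ω (𝓝[>] s) (𝓝 (ω s))
  left_lim : ∀ s, ∃ l, Tendsto ω (𝓝[<] s) (𝓝 l)
  left_cont_end : ∀ s : Icc (0 : ℝ) t, (s : ℝ) = t → Tendsto ω (𝓝[<] s) (𝓝 (ω s))

variable (K) in
/-- The path space `D[0,t]`. As a subtype of `[0,t] → K` it carries the σ-algebra generated by the
coordinates `ω ↦ ω(s)`. -/
abbrev SkorokhodSpace (t : ℝ) : Type _ := {ω : Icc (0 : ℝ) t → K // IsSkorokhod ω}

variable [MeasurableSpace K]

open Classical in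
/-- `P` is the probability measure `𝐏ⁿ_a` on `D[0,t]`: for `0 ≤ t_1 < ⋯ < t_N ≤ t` and Borel sets
`J_1, …, J_N`,
`P(ω(t_i) ∈ J_i) = ∑_{b_i ∈ J_i ∩ X_n} ∏_i p_{t_i - t_{i-1}, n}(b_i - b_{i-1}) q⁻ⁿ`,
where `t_0 = 0` and `b_0 = a`. -/
def IsPathMeasure (S : Finset K) (β : K) (χ : AddChar K Circle) (α : ℝ) (n : ℕ) (t : ℝ) (a : K)
    (P : Measure (SkorokhodSpace K t)) : Prop :=
  IsProbabilityMeasure P ∧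
    ∀ (N : ℕ) (τ : Fin N → Icc (0 : ℝ) t) (J : Fin N → Set K), StrictMono τ →
      (∀ i, MeasurableSet (J i)) →
      P.real {ω | ∀ i, ω.1 (τ i) ∈ J i} =
        ∑ b ∈ Fintype.piFinset (fun i => (grid S β n).filter (· ∈ J i)),
          ∏ i : Fin N,
            density S β χ α n
              ((τ i : ℝ) - (Fin.cons 0 (fun j => (τ j : ℝ)) : Fin (N + 1) → ℝ) i.castSucc)
              (b i - (Fin.cons a b : Fin (N + 1) → K) i.castSucc) *
            ((S.card : ℝ) ^ n)⁻¹

/-- The measure `𝐏ⁿ_a` on `D[0,t]`, determined by its finite-dimensional distributions. -/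
def pathMeasure (S : Finset K) (β : K) (χ : AddChar K Circle) (α : ℝ) (n : ℕ) (t : ℝ) (a : K) :
    Measure (SkorokhodSpace K t) :=
  Classical.epsilon (IsPathMeasure S β χ α n t a)

/-- The conditioned measure `𝐏ⁿ_{a,b,t}(A) = 𝐏ⁿ_a(A ∩ (ω(t) = b)) / 𝐏ⁿ_a(ω(t) = b)`. -/
def bridgeMeasure (S : Finset K) (β : K) (χ : AddChar K Circle) (α : ℝ) (n : ℕ) {t : ℝ}
    (ht : 0 < t) (a b : K) : Measure (SkorokhodSpace K t) :=
  ProbabilityTheory.cond (pathMeasure S β χ α n t a) {ω | ω.1 ⟨t, ht.le, le_rfl⟩ = b}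

/-- The propagator
`Kⁿ_t(x,y) = (∫_{D[0,t]} e^{-∫_0^t v(ω(s)) ds} d𝐏ⁿ_{x,y,t}(ω)) · p_{t,n}(y - x)`. -/
def propagator (S : Finset K) (β : K) (χ : AddChar K Circle) (α : ℝ) (v : K → ℝ) (n : ℕ) {t : ℝ}
    (ht : 0 < t) (x y : K) : ℝ :=
  (∫ ω, Real.exp (-∫ s in (0 : ℝ)..t, v (ω.1 (projIcc 0 t ht.le s))) ∂(bridgeMeasure S β χ α n ht x y)) *
    density S β χ α n t (y - x)

/-- `v*(x) = inf_{|y| = |x|} v(y)`. -/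
def sphereInf (v : K → ℝ) (x : K) : ℝ := sInf (v '' {y | ‖y‖ = ‖x‖})

end Paths

end LocalFieldPropagator

end

/-!
By Jensen's inequality `e^{-∫ v(ω(s)) ds}` is at most the time average of `e^{-t v(ω(s))}`, so by
Fubini's theorem only the position of a loop based at `x` at a single time `s` matters. By the
ultrametric inequality `|ω(s)| = |x|` if `ω(s)` lies in the largest ball around `x` that misses `0`,
and then the integrand is at most `e^{-t v*(x)}`. Loops outside that ball at time `s` have mass of
order `t |x|^{-α}`: one of `s`, `t - s` is at least `t / 2`, so one of the two transition densities
is bounded uniformly in `n`, and the other is summed over the complement of a ball, where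
orthogonality of characters gives its mass explicitly.

The measure `𝐏ⁿ_a` is the law of a compound Poisson process. The finite Fourier transform turns the
semigroup property into the addition of exponents, and the jump law, the inverse transform of
`max |ξ|^α - |ξ|^α`, is nonnegative because a radially decreasing function is a nonnegative
combination of indicators of balls, whose transforms are nonnegative.
-/

noncomputable section

namespace LocalFieldPropagator

section Grid

variable {K : Type*} [NontriviallyNormedField K] {β : K} {S : Finset K} {n : ℕ} {r s : ℤ}
  {x y : K}

lemma IsUniformizer.norm_lt_one_iff_exists (hβ : IsUniformizer β) :
    ‖x‖ < 1 ↔ ∃ y : K, ‖y‖ ≤ 1 ∧ β * y = x :=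
  Set.ext_iff.1 hβ x

lemma IsUniformizer.norm_lt_one (hβ : IsUniformizer β) : ‖β‖ < 1 :=
  hβ.norm_lt_one_iff_exists.2 ⟨1, norm_one.le, mul_one β⟩

lemma IsUniformizer.ne_zero (hβ : IsUniformizer β) : β ≠ 0 := by
  rintro rfl
  obtain ⟨x, hx_pos, hx_lt⟩ := NormedField.exists_norm_lt_one K
  obtain ⟨y, -, hy⟩ := hβ.norm_lt_one_iff_exists.1 hx_lt
  exact norm_pos_iff.1 hx_pos (by rw [← hy, zero_mul])

lemma IsUniformizer.norm_pos (hβ : IsUniformizer β) : 0 < ‖β‖ := norm_pos_iff.2 hβ.ne_zero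

lemma IsUniformizer.norm_lt_one_iff (hβ : IsUniformizer β) : ‖x‖ < 1 ↔ ‖x‖ ≤ ‖β‖ := by
  refine ⟨fun hx => ?_, fun hx => hx.trans_lt hβ.norm_lt_one⟩
  obtain ⟨y, hy, rfl⟩ := hβ.norm_lt_one_iff_exists.1 hx
  simpa only [norm_mul] using mul_le_of_le_one_right (norm_nonneg β) hy

lemma IsUniformizer.exists_norm_eq (hβ : IsUniformizer β) (hx : x ≠ 0) :
    ∃ r : ℤ, ‖x‖ = ‖β‖ ^ (-r) := by
  obtain ⟨r, hle, hlt⟩ := exists_mem_Ico_zpow (norm_pos_iff.2 hx)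
    ((one_lt_inv₀ hβ.norm_pos).2 hβ.norm_lt_one)
  simp only [inv_zpow'] at hle hlt
  have hpow : 0 < ‖β‖ ^ (r + 1) := zpow_pos hβ.norm_pos _
  have hscaled : ‖x * β ^ (r + 1)‖ ≤ ‖β‖ := by
    rw [← hβ.norm_lt_one_iff, norm_mul, norm_zpow, ← lt_div_iff₀ hpow, one_div, ← zpow_neg]
    exact hlt
  rw [norm_mul, norm_zpow, zpow_add_one₀ hβ.norm_pos.ne', ← mul_assoc,
    mul_le_iff_le_one_left hβ.norm_pos, ← le_div_iff₀ (zpow_pos hβ.norm_pos r), one_div,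
    ← zpow_neg] at hscaled
  exact ⟨r, le_antisymm hscaled hle⟩

lemma IsUniformizer.mem_ball_iff (hβ : IsUniformizer β) : x ∈ ball β r ↔ ‖x‖ ≤ ‖β‖ ^ (-r) := by
  have hpow : 0 < ‖β‖ ^ (-r) := zpow_pos hβ.norm_pos _
  constructor
  · rintro ⟨y, hy, rfl⟩
    simpa only [norm_mul, norm_zpow] using mul_le_of_le_one_right hpow.le hy
  · intro hx
    refine ⟨(β ^ (-r))⁻¹ * x, ?_, mul_inv_cancel_left₀ (zpow_ne_zero _ hβ.ne_zero) x⟩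
    rw [mem_ofPred_eq, norm_mul, norm_inv, norm_zpow, inv_mul_le_iff₀ hpow, mul_one]
    exact hx

lemma IsUniformizer.ball_subset_ball (hβ : IsUniformizer β) (hrs : r ≤ s) :
    ball β r ⊆ ball β s := by
  intro x hx
  rw [hβ.mem_ball_iff] at hx ⊢
  exact hx.trans
    (zpow_le_zpow_right_of_le_one₀ hβ.norm_pos hβ.norm_lt_one.le (neg_le_neg hrs))

lemma IsUniformizer.mul_mem_ball (hβ : IsUniformizer β) (hx : x ∈ ball β r) (hy : y ∈ ball β s) :
    x * y ∈ ball β (r + s) := by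
  rw [hβ.mem_ball_iff] at hx hy ⊢
  rw [norm_mul, neg_add, zpow_add₀ hβ.norm_pos.ne']
  gcongr

lemma zero_mem_ball (β : K) (r : ℤ) : 0 ∈ ball β r := ⟨0, by simp, mul_zero _⟩

lemma neg_mem_ball (hx : x ∈ ball β r) : -x ∈ ball β r := by
  obtain ⟨y, hy, rfl⟩ := hx
  exact ⟨-y, by simpa using hy, mul_neg _ _⟩

variable [IsUltrametricDist K]

lemma add_mem_ball (hx : x ∈ ball β r) (hy : y ∈ ball β r) : x + y ∈ ball β r := by
  obtain ⟨x', hx', rfl⟩ := hx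
  obtain ⟨y', hy', rfl⟩ := hy
  exact ⟨x' + y', (IsUltrametricDist.norm_add_le_max x' y').trans (max_le hx' hy'), mul_add _ _ _⟩

lemma sub_mem_ball (hx : x ∈ ball β r) (hy : y ∈ ball β r) : x - y ∈ ball β r :=
  sub_eq_add_neg x y ▸ add_mem_ball hx (neg_mem_ball hy)

lemma sum_mem_ball {ι : Type*} {I : Finset ι} {f : ι → K} (hf : ∀ i ∈ I, f i ∈ ball β r) :
    ∑ i ∈ I, f i ∈ ball β r :=
  Finset.sum_induction f (· ∈ ball β r) (fun _ _ => add_mem_ball) (zero_mem_ball β r) hf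

lemma add_mem_ball_iff (hx : x ∈ ball β r) : x + y ∈ ball β r ↔ y ∈ ball β r :=
  ⟨fun h => by simpa using sub_mem_ball h hx, add_mem_ball hx⟩

/-- The element `∑ a_i β^(m+i)` of `K` with digits `a_0, …, a_{l-1}` starting at the power `β^m`;
the points of the grid `X_n` are those with `m = -n` and `l = 2n`. -/
def digitSum (β : K) (m : ℤ) {l : ℕ} (a : Fin l → S) : K := ∑ i, (a i : K) * β ^ ((i : ℤ) + m)

omit [IsUltrametricDist K] in
lemma mem_grid_iff : x ∈ grid S β n ↔ ∃ a : Fin (2 * n) → S, digitSum β (-n) a = x := by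
  simp only [grid, digitSum, Finset.mem_image, Finset.mem_univ, true_and, sub_eq_add_neg]

omit [IsUltrametricDist K] in
lemma digitSum_cons (β : K) (m : ℤ) {l : ℕ} (s : S) (a : Fin l → S) :
    digitSum β m (Fin.cons s a : Fin (l + 1) → S) = s * β ^ m + digitSum β (m + 1) a := by
  simp only [digitSum, Fin.sum_univ_succ, Fin.cons_zero, Fin.cons_succ, Fin.val_zero, Fin.val_succ,
    Nat.cast_zero, zero_add, Nat.cast_add, Nat.cast_one, add_assoc, add_comm (1 : ℤ)]

lemma IsUniformizer.digitSum_mem_ball (hβ : IsUniformizer β) (hS : IsDigitSet S) (m : ℤ) {l : ℕ}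
    (a : Fin l → S) : digitSum β m a ∈ ball β (-m) := by
  refine sum_mem_ball fun i _ => ?_
  rw [hβ.mem_ball_iff, norm_mul, norm_zpow, neg_neg]
  calc ‖(a i : K)‖ * ‖β‖ ^ ((i : ℤ) + m)
    _ ≤ ‖β‖ ^ ((i : ℤ) + m) :=
      mul_le_of_le_one_left (zpow_pos hβ.norm_pos _).le (hS.norm_le_one _ (a i).2)
    _ ≤ ‖β‖ ^ m := zpow_le_zpow_right_of_le_one₀ hβ.norm_pos hβ.norm_lt_one.le (by lia)

omit [IsUltrametricDist K] in
lemma IsUniformizer.existsUnique_digit (hβ : IsUniformizer β) (hS : IsDigitSet S) {m : ℤ}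
    (hx : x ∈ ball β (-m)) : ∃! s : S, x - s * β ^ m ∈ ball β (-(m + 1)) := by
  obtain ⟨y, hy, rfl⟩ := hx
  have hiff : ∀ s : K, β ^ m * y - s * β ^ m ∈ ball β (-(m + 1)) ↔ ‖y - s‖ < 1 := by
    intro s
    rw [hβ.mem_ball_iff, hβ.norm_lt_one_iff, mul_comm s, ← mul_sub, norm_mul, norm_zpow, neg_neg,
      zpow_add_one₀ hβ.norm_pos.ne', mul_le_mul_iff_right₀ (zpow_pos hβ.norm_pos m)]
  obtain ⟨s, ⟨hs, hys⟩, hunique⟩ := hS.existsUnique_rep y hy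
  simp only [neg_neg, hiff]
  exact ⟨⟨s, hs⟩, hys, fun s' hs' => Subtype.ext (hunique s' ⟨s'.2, hs'⟩)⟩

theorem IsUniformizer.existsUnique_digitSum (hβ : IsUniformizer β) (hS : IsDigitSet S) {m : ℤ}
    (l : ℕ) (hx : x ∈ ball β (-m)) :
    ∃! a : Fin l → S, x - digitSum β m a ∈ ball β (-(m + l)) := by
  induction l generalizing m x with
  | zero =>
    exact ⟨fun i => i.elim0, by simpa [digitSum] using hx, fun a _ => funext fun i => i.elim0⟩
  | succ l ih =>
    have hexp : -(m + (l + 1 : ℕ)) = -(m + 1 + l) := by push_cast; ring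
    obtain ⟨s, hs, hs_unique⟩ := hβ.existsUnique_digit hS hx
    obtain ⟨a, ha, ha_unique⟩ := ih hs
    refine ⟨Fin.cons s a, ?_, fun c hc => ?_⟩
    · simpa only [digitSum_cons, hexp, ← sub_sub] using ha
    · obtain ⟨s', a', rfl⟩ : ∃ s' a', c = Fin.cons s' a' := ⟨_, _, (Fin.cons_self_tail c).symm⟩
      simp only [digitSum_cons, hexp, ← sub_sub] at hc
      have hs' : x - s' * β ^ m ∈ ball β (-(m + 1)) := by
        have := add_mem_ball (hβ.ball_subset_ball (by lia) hc) (hβ.digitSum_mem_ball hS (m + 1) a')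
        rwa [sub_add_cancel] at this
      obtain rfl := hs_unique s' hs'
      rw [ha_unique a' hc]

omit [IsUltrametricDist K] in
lemma IsDigitSet.zero_mem_grid (hS : IsDigitSet S) : (0 : K) ∈ grid S β n :=
  mem_grid_iff.2 ⟨fun _ => ⟨0, hS.zero_mem⟩, by simp [digitSum]⟩

lemma IsUniformizer.mem_ball_of_mem_grid (hβ : IsUniformizer β) (hS : IsDigitSet S)
    (hx : x ∈ grid S β n) : x ∈ ball β n := by
  obtain ⟨a, rfl⟩ := mem_grid_iff.1 hx
  simpa only [neg_neg] using hβ.digitSum_mem_ball hS (-n) a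

lemma IsUniformizer.sub_mem_ball_of_mem_grid (hβ : IsUniformizer β) (hS : IsDigitSet S)
    (hx : x ∈ grid S β n) (hy : y ∈ grid S β n) : x - y ∈ ball β n :=
  sub_mem_ball (hβ.mem_ball_of_mem_grid hS hx) (hβ.mem_ball_of_mem_grid hS hy)

theorem IsUniformizer.existsUnique_mem_grid (hβ : IsUniformizer β) (hS : IsDigitSet S)
    (hx : x ∈ ball β n) : ∃! ξ, ξ ∈ grid S β n ∧ x - ξ ∈ ball β (-n) := by
  have hexp : -(-(n : ℤ) + (2 * n : ℕ)) = -n := by push_cast; ring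
  obtain ⟨a, ha, hunique⟩ := hβ.existsUnique_digitSum hS (m := -n) (2 * n) (by simpa using hx)
  rw [hexp] at ha hunique
  refine ⟨digitSum β (-n) a, ⟨mem_grid_iff.2 ⟨a, rfl⟩, ha⟩, fun ξ ⟨hξ, hxξ⟩ => ?_⟩
  obtain ⟨c, rfl⟩ := mem_grid_iff.1 hξ
  rw [hunique c hxξ]

lemma IsUniformizer.eq_of_sub_mem_ball (hβ : IsUniformizer β) (hS : IsDigitSet S)
    (hx : x ∈ grid S β n) (hy : y ∈ grid S β n) (hxy : x - y ∈ ball β (-n)) : x = y :=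
  (hβ.existsUnique_mem_grid hS (hβ.mem_ball_of_mem_grid hS hx)).unique
    ⟨hx, by simpa only [sub_self] using zero_mem_ball β _⟩ ⟨hy, hxy⟩

/-- The representative in `grid S β n` of the class of `x` modulo `ball β (-n)`; meaningful for
`x ∈ ball β n` only. -/
def gridRep (S : Finset K) (β : K) (n : ℕ) (x : K) : K :=
  Classical.epsilon fun ξ => ξ ∈ grid S β n ∧ x - ξ ∈ ball β (-n)

lemma IsUniformizer.gridRep_mem (hβ : IsUniformizer β) (hS : IsDigitSet S) (hx : x ∈ ball β n) :
    gridRep S β n x ∈ grid S β n :=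
  (Classical.epsilon_spec (hβ.existsUnique_mem_grid hS hx).exists).1

lemma IsUniformizer.sub_gridRep_mem_ball (hβ : IsUniformizer β) (hS : IsDigitSet S)
    (hx : x ∈ ball β n) : x - gridRep S β n x ∈ ball β (-n) :=
  (Classical.epsilon_spec (hβ.existsUnique_mem_grid hS hx).exists).2

lemma IsUniformizer.gridRep_eq_iff (hβ : IsUniformizer β) (hS : IsDigitSet S)
    (hx : x ∈ ball β n) (hy : y ∈ grid S β n) :
    gridRep S β n x = y ↔ x - y ∈ ball β (-n) :=
  ⟨fun h => h ▸ hβ.sub_gridRep_mem_ball hS hx, fun h => (hβ.existsUnique_mem_grid hS hx).unique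
    ⟨hβ.gridRep_mem hS hx, hβ.sub_gridRep_mem_ball hS hx⟩ ⟨hy, h⟩⟩

/-- A function on `ball β n` that descends to the finite group `ball β n / ball β (-n)`. -/
def IsGridPeriodic {M : Type*} (β : K) (n : ℕ) (f : K → M) : Prop :=
  ∀ z ∈ ball β n, ∀ w ∈ ball β (-n), f (z + w) = f z

lemma IsGridPeriodic.gridRep_apply {M : Type*} {f : K → M} (hf : IsGridPeriodic β n f)
    (hβ : IsUniformizer β) (hS : IsDigitSet S) (hx : x ∈ ball β n) :
    f (gridRep S β n x) = f x := by
  rw [← hf _ (hβ.mem_ball_of_mem_grid hS (hβ.gridRep_mem hS hx)) _ (hβ.sub_gridRep_mem_ball hS hx),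
    add_sub_cancel]

theorem IsGridPeriodic.sum_grid_add {M : Type*} [AddCommMonoid M] {f : K → M}
    (hf : IsGridPeriodic β n f) (hβ : IsUniformizer β) (hS : IsDigitSet S) {h : K}
    (hh : h ∈ ball β n) : ∑ ξ ∈ grid S β n, f (ξ + h) = ∑ ξ ∈ grid S β n, f ξ := by
  have hadd : ∀ ξ ∈ grid S β n, ξ + h ∈ ball β n := fun ξ hξ =>
    add_mem_ball (hβ.mem_ball_of_mem_grid hS hξ) hh
  have hmaps : Set.MapsTo (fun ξ => gridRep S β n (ξ + h)) (grid S β n) (grid S β n) :=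
    fun ξ hξ => hβ.gridRep_mem hS (hadd ξ hξ)
  have hinj : Set.InjOn (fun ξ => gridRep S β n (ξ + h)) (grid S β n) := by
    intro ξ hξ η hη (heq : gridRep S β n (ξ + h) = gridRep S β n (η + h))
    rw [hβ.gridRep_eq_iff hS (hadd ξ hξ) (hmaps hη)] at heq
    refine hβ.eq_of_sub_mem_ball hS hξ hη ?_
    simpa using sub_mem_ball heq (hβ.sub_gridRep_mem_ball hS (hadd η hη))
  exact Finset.sum_nbij (fun ξ => gridRep S β n (ξ + h)) hmaps hinj
    (Finset.surjOn_of_injOn_of_card_le _ hmaps hinj le_rfl)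
    fun ξ hξ => (hf.gridRep_apply hβ hS (hadd ξ hξ)).symm

open Classical in
/-- The grid points in `ball β r`; for `-n ≤ r ≤ n` they represent the subgroup
`ball β r / ball β (-n)`. -/
def ballGrid (S : Finset K) (β : K) (n : ℕ) (r : ℤ) : Finset K :=
  (grid S β n).filter (· ∈ ball β r)

omit [IsUltrametricDist K] in
lemma mem_ballGrid_iff : x ∈ ballGrid S β n r ↔ x ∈ grid S β n ∧ x ∈ ball β r := by
  simp only [ballGrid, Finset.mem_filter]

lemma IsUniformizer.ballGrid_self (hβ : IsUniformizer β) (hS : IsDigitSet S) :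
    ballGrid S β n n = grid S β n :=
  Finset.ext fun _ => mem_ballGrid_iff.trans (and_iff_left_of_imp (hβ.mem_ball_of_mem_grid hS))

lemma IsUniformizer.gridRep_mem_ballGrid (hβ : IsUniformizer β) (hS : IsDigitSet S)
    (hr : -(n : ℤ) ≤ r) (hrn : r ≤ n) (hx : x ∈ ball β r) :
    gridRep S β n x ∈ ballGrid S β n r := by
  have hx_n : x ∈ ball β n := hβ.ball_subset_ball hrn hx
  refine mem_ballGrid_iff.2 ⟨hβ.gridRep_mem hS hx_n, ?_⟩
  simpa only [sub_sub_cancel] using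
    sub_mem_ball hx (hβ.ball_subset_ball hr (hβ.sub_gridRep_mem_ball hS hx_n))

theorem IsUniformizer.card_ballGrid (hβ : IsUniformizer β) (hS : IsDigitSet S)
    (hr : -(n : ℤ) ≤ r) (hrn : r ≤ n) :
    ((ballGrid S β n r).card : ℝ) = (S.card : ℝ) ^ (n + r) := by
  obtain ⟨l, hl⟩ : ∃ l : ℕ, (l : ℤ) = n + r := ⟨(n + r).toNat, Int.toNat_of_nonneg (by lia)⟩
  have hexp : -(-r + (l : ℤ)) = -n := by lia
  have hsum_r : ∀ a : Fin l → S, digitSum β (-r) a ∈ ball β r := fun a => by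
    simpa only [neg_neg] using hβ.digitSum_mem_ball hS (-r) a
  have hsum : ∀ a : Fin l → S, digitSum β (-r) a ∈ ball β n := fun a =>
    hβ.ball_subset_ball hrn (hsum_r a)
  have hdigits : ∀ x ∈ ball β r, ∃! a : Fin l → S, x - digitSum β (-r) a ∈ ball β (-n) := by
    intro x hx
    simpa only [hexp] using hβ.existsUnique_digitSum hS (m := -r) l (by simpa using hx)
  have hbij : Set.BijOn (fun a : Fin l → S => gridRep S β n (digitSum β (-r) a))
      (Finset.univ : Finset (Fin l → S)) (ballGrid S β n r) := by
    refine ⟨fun a _ => hβ.gridRep_mem_ballGrid hS hr hrn (hsum_r a),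
      fun a _ c _ (hac : gridRep S β n _ = gridRep S β n _) => ?_, fun x hx => ?_⟩
    · rw [hβ.gridRep_eq_iff hS (hsum a) (hβ.gridRep_mem hS (hsum c))] at hac
      refine (hdigits _ (hsum_r a)).unique (by simpa using zero_mem_ball β _) ?_
      simpa using sub_mem_ball hac (hβ.sub_gridRep_mem_ball hS (hsum c))
    · obtain ⟨hx_grid, hx_ball⟩ := mem_ballGrid_iff.1 (Finset.mem_coe.1 hx)
      obtain ⟨a, ha, -⟩ := hdigits x hx_ball
      refine ⟨a, Finset.mem_coe.2 (Finset.mem_univ a), ?_⟩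
      exact (hβ.gridRep_eq_iff hS (hsum a) hx_grid).2 (neg_sub x _ ▸ neg_mem_ball ha)
  rw [← Finset.card_nbij _ hbij.mapsTo hbij.injOn hbij.surjOn, Finset.card_univ, Fintype.card_fun,
    Fintype.card_fin, Fintype.card_coe, ← hl, zpow_natCast, Nat.cast_pow]

end Grid

section Characters

variable {K : Type*} [NontriviallyNormedField K] {β : K} {S : Finset K} {χ : AddChar K Circle}
  {n : ℕ} {r : ℤ} {x z : K}

lemma IsDigitSet.card_pos (hS : IsDigitSet S) : (0 : ℝ) < S.card :=
  Nat.cast_pos.2 (Finset.card_pos.2 ⟨0, hS.zero_mem⟩)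

lemma IsRankZeroCharacter.apply_eq_one (hχ : IsRankZeroCharacter β χ) (hx : x ∈ ball β 0) :
    χ x = 1 :=
  hχ.2.1 x hx

lemma IsRankZeroCharacter.exists_apply_ne_one (hχ : IsRankZeroCharacter β χ) :
    ∃ x ∈ ball β 1, χ x ≠ 1 := by
  by_contra! h
  exact absurd (hχ.2.2 h) (by decide)

lemma IsRankZeroCharacter.isGridPeriodic_mul_left (hχ : IsRankZeroCharacter β χ)
    (hβ : IsUniformizer β) (hz : z ∈ ball β n) : IsGridPeriodic β n fun x => (χ (z * x) : ℂ) := by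
  intro x _ w hw
  have hzw : z * w ∈ ball β 0 := by simpa using hβ.mul_mem_ball hz hw
  simp only [mul_add, AddChar.map_add_eq_mul, hχ.apply_eq_one hzw, mul_one]

lemma IsUniformizer.norm_eq_of_mem_ball_of_notMem_ball (hβ : IsUniformizer β)
    (hx : x ∈ ball β (r + 1)) (hx' : x ∉ ball β r) : ‖x‖ = ‖β‖ ^ (-(r + 1)) := by
  obtain ⟨m, hm⟩ := hβ.exists_norm_eq (x := x) fun h => hx' (h ▸ zero_mem_ball β r)
  rw [hβ.mem_ball_iff, hm, zpow_le_zpow_iff_right_of_lt_one₀ hβ.norm_pos hβ.norm_lt_one] at hx hx'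
  rw [hm, show m = r + 1 by lia]

variable [IsUltrametricDist K]

lemma IsGridPeriodic.indicator_ball {M : Type*} [Zero M] {f : K → M} (hf : IsGridPeriodic β n f)
    (hβ : IsUniformizer β) (hr : -(n : ℤ) ≤ r) : IsGridPeriodic β n ((ball β r).indicator f) := by
  classical
  intro z hz w hw
  have hmem : z + w ∈ ball β r ↔ z ∈ ball β r :=
    add_comm z w ▸ add_mem_ball_iff (hβ.ball_subset_ball hr hw)
  simp only [Set.indicator_apply, hmem, hf z hz w hw]

omit [IsUltrametricDist K] in
lemma sum_ballGrid_eq_sum_indicator {M : Type*} [AddCommMonoid M] (f : K → M) :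
    ∑ ξ ∈ ballGrid S β n r, f ξ = ∑ ξ ∈ grid S β n, (ball β r).indicator f ξ := by
  classical
  simp only [ballGrid, Finset.sum_filter, Set.indicator_apply]

lemma IsGridPeriodic.sum_ballGrid_add {M : Type*} [AddCommMonoid M] {f : K → M}
    (hf : IsGridPeriodic β n f) (hβ : IsUniformizer β) (hS : IsDigitSet S) (hr : -(n : ℤ) ≤ r)
    (hrn : r ≤ n) {h : K} (hh : h ∈ ball β r) :
    ∑ ξ ∈ ballGrid S β n r, f (ξ + h) = ∑ ξ ∈ ballGrid S β n r, f ξ := by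
  classical
  rw [sum_ballGrid_eq_sum_indicator f,
    ← (hf.indicator_ball hβ hr).sum_grid_add hβ hS (hβ.ball_subset_ball hrn hh),
    sum_ballGrid_eq_sum_indicator]
  simp only [Set.indicator_apply, add_comm _ h, add_mem_ball_iff hh]

theorem IsRankZeroCharacter.sum_ballGrid_apply_mul (hχ : IsRankZeroCharacter β χ)
    (hβ : IsUniformizer β) (hS : IsDigitSet S) (hr : -(n : ℤ) ≤ r) (hrn : r ≤ n)
    (hz : z ∈ ball β n) :
    ∑ ξ ∈ ballGrid S β n r, (χ (z * ξ) : ℂ) =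
      (ball β (-r)).indicator (fun _ => ((ballGrid S β n r).card : ℂ)) z := by
  by_cases hzr : z ∈ ball β (-r)
  · have hone : ∀ ξ ∈ ballGrid S β n r, (χ (z * ξ) : ℂ) = 1 := by
      intro ξ hξ
      have hzξ : z * ξ ∈ ball β 0 := by
        simpa using hβ.mul_mem_ball hzr (mem_ballGrid_iff.1 hξ).2
      rw [hχ.apply_eq_one hzξ, Circle.coe_one]
    rw [Finset.sum_congr rfl hone, Set.indicator_of_mem hzr, Finset.sum_const, nsmul_eq_mul,
      mul_one]
  · have hz0 : z ≠ 0 := fun h => hzr (h ▸ zero_mem_ball β _)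
    obtain ⟨x, hx, hχx⟩ := hχ.exists_apply_ne_one
    have hxz : x / z ∈ ball β r := by
      obtain ⟨m, hm⟩ := hβ.exists_norm_eq hz0
      rw [hβ.mem_ball_iff, hm,
        zpow_le_zpow_iff_right_of_lt_one₀ hβ.norm_pos hβ.norm_lt_one] at hzr
      rw [hβ.mem_ball_iff] at hx ⊢
      rw [norm_div, hm, div_le_iff₀ (zpow_pos hβ.norm_pos _), ← zpow_add₀ hβ.norm_pos.ne']
      exact hx.trans
        (zpow_le_zpow_right_of_le_one₀ hβ.norm_pos hβ.norm_lt_one.le (by lia))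
    have hshift := (hχ.isGridPeriodic_mul_left hβ hz).sum_ballGrid_add hβ hS hr hrn hxz
    simp only [mul_add, AddChar.map_add_eq_mul, Circle.coe_mul, ← Finset.sum_mul,
      mul_div_cancel₀ x hz0] at hshift
    rw [Set.indicator_of_notMem hzr]
    by_contra hne
    exact hχx (Circle.ext ((mul_eq_left₀ hne).1 hshift))

lemma IsUniformizer.card_grid (hβ : IsUniformizer β) (hS : IsDigitSet S) (n : ℕ) :
    ((grid S β n).card : ℝ) = (S.card : ℝ) ^ n * (S.card : ℝ) ^ n := by
  rw [← hβ.ballGrid_self hS, hβ.card_ballGrid hS (by lia) le_rfl, zpow_add₀ hS.card_pos.ne',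
    zpow_natCast]

lemma IsRankZeroCharacter.sum_grid_apply_mul (hχ : IsRankZeroCharacter β χ) (hβ : IsUniformizer β)
    (hS : IsDigitSet S) (hz : z ∈ ball β n) :
    ∑ ξ ∈ grid S β n, (χ (z * ξ) : ℂ) =
      (ball β (-n)).indicator (fun _ => (S.card : ℂ) ^ n * (S.card : ℂ) ^ n) z := by
  have hcard : ((grid S β n).card : ℂ) = (S.card : ℂ) ^ n * (S.card : ℂ) ^ n := by
    exact_mod_cast hβ.card_grid hS n
  rw [← hcard, ← hβ.ballGrid_self hS, hχ.sum_ballGrid_apply_mul hβ hS (by lia) le_rfl hz]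

lemma IsUniformizer.ballGrid_neg (hβ : IsUniformizer β) (hS : IsDigitSet S) :
    ballGrid S β n (-n) = {0} := by
  ext ξ
  rw [mem_ballGrid_iff, Finset.mem_singleton]
  constructor
  · rintro ⟨hξ, hξ_ball⟩
    exact hβ.eq_of_sub_mem_ball hS hξ hS.zero_mem_grid (by simpa using hξ_ball)
  · rintro rfl
    exact ⟨hS.zero_mem_grid, zero_mem_ball β _⟩

open scoped ComplexOrder

/-- A radially decreasing function is a positive combination of indicators of balls, and those have
nonnegative transforms by orthogonality. -/
theorem IsRankZeroCharacter.sum_ballGrid_antitone_nonneg (hχ : IsRankZeroCharacter β χ)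
    (hβ : IsUniformizer β) (hS : IsDigitSet S) (hz : z ∈ ball β n) (hr : -(n : ℤ) ≤ r)
    (hrn : r ≤ n) {g : ℝ → ℝ} (hg : AntitoneOn g (Ici 0)) (hg_nonneg : 0 ≤ g (‖β‖ ^ (-r))) :
    0 ≤ ∑ ξ ∈ ballGrid S β n r, (g ‖ξ‖ : ℂ) * χ (z * ξ) := by
  have hpow : ∀ m : ℤ, ‖β‖ ^ m ∈ Ici 0 := fun m => (zpow_pos hβ.norm_pos m).le
  induction r, hr using Int.leInduction generalizing g with
  | base =>
    rw [hβ.ballGrid_neg hS, Finset.sum_singleton, norm_zero, mul_zero, AddChar.map_zero_eq_one,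
      Circle.coe_one, mul_one, Complex.zero_le_real]
    exact hg_nonneg.trans (hg self_mem_Ici (hpow _) (hpow _))
  | succ r hr ih =>
    set c : ℝ := g (‖β‖ ^ (-(r + 1))) with hc
    have hinner : 0 ≤ ∑ ξ ∈ ballGrid S β n r, ((g ‖ξ‖ - c : ℝ) : ℂ) * χ (z * ξ) := by
      refine ih (by lia) (g := fun y => g y - c)
        (fun x hx y hy hxy => sub_le_sub_right (hg hx hy hxy) c)
        (sub_nonneg.2 (hg (hpow _) (hpow _) ?_))
      exact zpow_le_zpow_right_of_le_one₀ hβ.norm_pos hβ.norm_lt_one.le (by lia)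
    have hball : 0 ≤ (c : ℂ) * ∑ ξ ∈ ballGrid S β n (r + 1), (χ (z * ξ) : ℂ) := by
      rw [hχ.sum_ballGrid_apply_mul hβ hS (by lia) hrn hz]
      exact mul_nonneg (Complex.zero_le_real.2 hg_nonneg)
        (Set.indicator_nonneg (fun _ _ => Nat.cast_nonneg _) z)
    have hsphere : ∑ ξ ∈ ballGrid S β n r, ((g ‖ξ‖ - c : ℝ) : ℂ) * χ (z * ξ) =
        ∑ ξ ∈ ballGrid S β n (r + 1), ((g ‖ξ‖ - c : ℝ) : ℂ) * χ (z * ξ) := by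
      refine Finset.sum_subset (fun ξ hξ => ?_) fun ξ hξ hξ' => ?_
      · rw [mem_ballGrid_iff] at hξ ⊢
        exact ⟨hξ.1, hβ.ball_subset_ball (by lia) hξ.2⟩
      · rw [mem_ballGrid_iff] at hξ hξ'
        rw [hβ.norm_eq_of_mem_ball_of_notMem_ball hξ.2 fun h => hξ' ⟨hξ.1, h⟩, ← hc, sub_self,
          Complex.ofReal_zero, zero_mul]
    rw [hsphere] at hinner
    refine (add_nonneg hinner hball).trans_eq ?_
    rw [Finset.mul_sum, ← Finset.sum_add_distrib]
    exact Finset.sum_congr rfl fun ξ _ => by push_cast; ring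

lemma IsRankZeroCharacter.finiteFourierInv_nonneg (hχ : IsRankZeroCharacter β χ)
    (hβ : IsUniformizer β) (hS : IsDigitSet S) (hz : z ∈ ball β n) {g : ℝ → ℝ}
    (hg : AntitoneOn g (Ici 0)) (hg_nonneg : 0 ≤ g (‖β‖ ^ (-(n : ℤ)))) :
    0 ≤ finiteFourierInv S β χ n (fun ξ => (g ‖ξ‖ : ℂ)) z := by
  have hsum := hχ.sum_ballGrid_antitone_nonneg hβ hS hz (by lia) le_rfl hg hg_nonneg
  rw [hβ.ballGrid_self hS] at hsum
  have hcard : (0 : ℂ) ≤ ((S.card : ℂ) ^ n)⁻¹ := by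
    rw [show ((S.card : ℂ) ^ n)⁻¹ = (((S.card : ℝ) ^ n)⁻¹ : ℝ) by push_cast; rfl,
      Complex.zero_le_real]
    positivity
  exact mul_nonneg hcard hsum

end Characters

section Density

variable {K : Type*} [NontriviallyNormedField K] {β : K} {S : Finset K} {χ : AddChar K Circle}
  {α s : ℝ} {n : ℕ} {r : ℤ} {x : K}

lemma antitoneOn_exp_neg_mul_rpow (hα : 0 ≤ α) (hs : 0 ≤ s) :
    AntitoneOn (fun y : ℝ => Real.exp (-s * y ^ α)) (Ici 0) := fun _ hx _ _ hxy =>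
  Real.exp_le_exp.2 (mul_le_mul_of_nonpos_left (Real.rpow_le_rpow hx hxy hα) (neg_nonpos.2 hs))

lemma density_neg (x : K) : density S β χ α n s (-x) = density S β χ α n s x := by
  unfold density finiteFourierInv
  rw [← Complex.conj_re]
  simp only [map_mul, map_inv₀, map_pow, Complex.conj_natCast, map_sum, Complex.conj_ofReal,
    neg_mul, AddChar.map_neg_eq_inv, Circle.coe_inv_eq_conj, Complex.conj_conj]

lemma density_eq_sum (x : K) : density S β χ α n s x =
    ((S.card : ℝ) ^ n)⁻¹ * ∑ ξ ∈ grid S β n, Real.exp (-s * ‖ξ‖ ^ α) * (χ (x * ξ) : ℂ).re := by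
  unfold density finiteFourierInv
  rw [show ((S.card : ℂ) ^ n)⁻¹ = (((S.card : ℝ) ^ n)⁻¹ : ℝ) by push_cast; rfl,
    Complex.re_ofReal_mul, Complex.re_sum]
  simp only [Complex.re_ofReal_mul]

lemma density_zero : density S β χ α n s 0 =
    ((S.card : ℝ) ^ n)⁻¹ * ∑ ξ ∈ grid S β n, Real.exp (-s * ‖ξ‖ ^ α) := by
  simp only [density_eq_sum, zero_mul, AddChar.map_zero_eq_one, Circle.coe_one, Complex.one_re,
    mul_one]

lemma density_le_density_zero (x : K) : density S β χ α n s x ≤ density S β χ α n s 0 := by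
  rw [density_zero, density_eq_sum]
  gcongr with ξ
  exact mul_le_of_le_one_right (Real.exp_pos _).le
    ((Complex.re_le_norm _).trans (Circle.norm_coe _).le)

lemma density_zero_antitone : Antitone fun s => density S β χ α n s (0 : K) := by
  intro s s' hss'
  simp only [density_zero]
  gcongr

lemma density_zero_pos (hS : IsDigitSet S) : 0 < density S β χ α n s 0 := by
  rw [density_zero]
  exact mul_pos (inv_pos.2 (pow_pos hS.card_pos n))
    (Finset.sum_pos (fun ξ _ => Real.exp_pos _) ⟨0, hS.zero_mem_grid⟩)

variable [IsUltrametricDist K]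

lemma IsRankZeroCharacter.isGridPeriodic_density (hχ : IsRankZeroCharacter β χ)
    (hβ : IsUniformizer β) (hS : IsDigitSet S) : IsGridPeriodic β n (density S β χ α n s) := by
  intro z hz w hw
  rw [density_eq_sum, density_eq_sum]
  congr 1
  refine Finset.sum_congr rfl fun ξ hξ => ?_
  have hperiodic : (χ (ξ * (z + w)) : ℂ) = χ (ξ * z) :=
    hχ.isGridPeriodic_mul_left hβ (hβ.mem_ball_of_mem_grid hS hξ) z hz w hw
  simp only [mul_comm _ ξ, hperiodic]

open scoped ComplexOrder in
lemma IsRankZeroCharacter.finiteFourierInv_exp_nonneg (hχ : IsRankZeroCharacter β χ)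
    (hβ : IsUniformizer β) (hS : IsDigitSet S) (hα : 0 ≤ α) (hs : 0 ≤ s) (hx : x ∈ ball β n) :
    0 ≤ finiteFourierInv S β χ n (fun ξ => (Real.exp (-s * ‖ξ‖ ^ α) : ℂ)) x :=
  hχ.finiteFourierInv_nonneg hβ hS hx (g := fun y => Real.exp (-s * y ^ α))
    (antitoneOn_exp_neg_mul_rpow hα hs) (Real.exp_pos _).le

theorem IsRankZeroCharacter.density_nonneg (hχ : IsRankZeroCharacter β χ) (hβ : IsUniformizer β)
    (hS : IsDigitSet S) (hα : 0 ≤ α) (hs : 0 ≤ s) (hx : x ∈ ball β n) :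
    0 ≤ density S β χ α n s x :=
  (Complex.le_def.1 (hχ.finiteFourierInv_exp_nonneg hβ hS hα hs hx)).1

lemma IsRankZeroCharacter.ofReal_density (hχ : IsRankZeroCharacter β χ) (hβ : IsUniformizer β)
    (hS : IsDigitSet S) (hα : 0 ≤ α) (hs : 0 ≤ s) (hx : x ∈ ball β n) :
    (density S β χ α n s x : ℂ) =
      finiteFourierInv S β χ n (fun ξ => (Real.exp (-s * ‖ξ‖ ^ α) : ℂ)) x :=
  Complex.ext rfl (Complex.le_def.1 (hχ.finiteFourierInv_exp_nonneg hβ hS hα hs hx)).2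

theorem IsRankZeroCharacter.sum_ballGrid_density (hχ : IsRankZeroCharacter β χ)
    (hβ : IsUniformizer β) (hS : IsDigitSet S) (hr : -(n : ℤ) ≤ r) (hrn : r ≤ n) :
    ∑ y ∈ ballGrid S β n r, density S β χ α n s y =
      (S.card : ℝ) ^ r * ∑ ξ ∈ ballGrid S β n (-r), Real.exp (-s * ‖ξ‖ ^ α) := by
  have horth : ∀ ξ ∈ grid S β n, ∑ y ∈ ballGrid S β n r, (χ (y * ξ) : ℂ).re =
      (ball β (-r)).indicator (fun _ => (S.card : ℝ) ^ (n + r)) ξ := by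
    intro ξ hξ
    have hsum := hχ.sum_ballGrid_apply_mul hβ hS hr hrn (hβ.mem_ball_of_mem_grid hS hξ)
    simp only [← Complex.re_sum, mul_comm _ ξ, hsum, ← hβ.card_ballGrid hS hr hrn]
    by_cases h : ξ ∈ ball β (-r) <;> simp [h]
  have hcoeff : ((S.card : ℝ) ^ n)⁻¹ * (S.card : ℝ) ^ (n + r) = (S.card : ℝ) ^ r := by
    rw [zpow_add₀ hS.card_pos.ne', zpow_natCast,
      inv_mul_cancel_left₀ (pow_ne_zero _ hS.card_pos.ne')]
  simp_rw [density_eq_sum]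
  rw [← Finset.mul_sum, Finset.sum_comm, ← hcoeff, mul_assoc, sum_ballGrid_eq_sum_indicator,
    Finset.mul_sum (a := (S.card : ℝ) ^ (n + r))]
  congr 1
  refine Finset.sum_congr rfl fun ξ hξ => ?_
  rw [← Finset.mul_sum, horth ξ hξ]
  by_cases h : ξ ∈ ball β (-r) <;> simp [h, mul_comm]

lemma IsRankZeroCharacter.sum_grid_density (hχ : IsRankZeroCharacter β χ) (hβ : IsUniformizer β)
    (hS : IsDigitSet S) (hα : 0 < α) :
    ∑ y ∈ grid S β n, density S β χ α n s y = (S.card : ℝ) ^ n := by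
  rw [← hβ.ballGrid_self hS, hχ.sum_ballGrid_density hβ hS (by lia) le_rfl, hβ.ballGrid_neg hS,
    Finset.sum_singleton, norm_zero, Real.zero_rpow hα.ne', mul_zero, Real.exp_zero, mul_one,
    zpow_natCast]

lemma IsRankZeroCharacter.sum_ballGrid_density_ge (hχ : IsRankZeroCharacter β χ)
    (hβ : IsUniformizer β) (hS : IsDigitSet S) (hα : 0 ≤ α) (hs : 0 ≤ s) (hr : -(n : ℤ) ≤ r)
    (hrn : r ≤ n) :
    (S.card : ℝ) ^ n * (1 - s * (‖β‖ ^ r) ^ α) ≤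
      ∑ y ∈ ballGrid S β n r, density S β χ α n s y := by
  have hexp : ∀ ξ ∈ ballGrid S β n (-r), 1 - s * (‖β‖ ^ r) ^ α ≤ Real.exp (-s * ‖ξ‖ ^ α) := by
    intro ξ hξ
    have hnorm : ‖ξ‖ ≤ ‖β‖ ^ r := by
      simpa only [neg_neg] using hβ.mem_ball_iff.1 (mem_ballGrid_iff.1 hξ).2
    calc 1 - s * (‖β‖ ^ r) ^ α
      _ ≤ 1 - s * ‖ξ‖ ^ α := by gcongr
      _ = -s * ‖ξ‖ ^ α + 1 := by ring
      _ ≤ Real.exp (-s * ‖ξ‖ ^ α) := Real.add_one_le_exp _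
  rw [hχ.sum_ballGrid_density hβ hS hr hrn]
  calc (S.card : ℝ) ^ n * (1 - s * (‖β‖ ^ r) ^ α)
    _ = (S.card : ℝ) ^ r * ((ballGrid S β n (-r)).card * (1 - s * (‖β‖ ^ r) ^ α)) := by
      rw [hβ.card_ballGrid hS (neg_le_neg hrn) (neg_le.1 hr), ← mul_assoc,
        ← zpow_add₀ hS.card_pos.ne', add_neg_cancel_comm_assoc, zpow_natCast]
    _ ≤ (S.card : ℝ) ^ r * ∑ ξ ∈ ballGrid S β n (-r), Real.exp (-s * ‖ξ‖ ^ α) := by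
      gcongr
      rw [← nsmul_eq_mul]
      exact Finset.card_nsmul_le_sum _ _ _ hexp

open Classical in
theorem IsRankZeroCharacter.sum_density_tail_le (hχ : IsRankZeroCharacter β χ)
    (hβ : IsUniformizer β) (hS : IsDigitSet S) (hα : 0 < α) (hs : 0 ≤ s) (hr : -(n : ℤ) ≤ r)
    (hrn : r ≤ n) (hx : x ∈ ball β n) :
    ∑ y ∈ grid S β n with y - x ∉ ball β r, density S β χ α n s (y - x) ≤
      (S.card : ℝ) ^ n * (s * (‖β‖ ^ r) ^ α) := by
  have hperiodic : IsGridPeriodic β n (density S β χ α n s) := hχ.isGridPeriodic_density hβ hS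
  have hmass : ∑ y ∈ grid S β n, density S β χ α n s (y - x) = (S.card : ℝ) ^ n := by
    simp only [sub_eq_add_neg, hperiodic.sum_grid_add hβ hS (neg_mem_ball hx),
      hχ.sum_grid_density hβ hS hα]
  have hball : ∑ y ∈ grid S β n with y - x ∈ ball β r, density S β χ α n s (y - x) =
      ∑ y ∈ ballGrid S β n r, density S β χ α n s y := by
    rw [sum_ballGrid_eq_sum_indicator,
      ← (hperiodic.indicator_ball hβ hr).sum_grid_add hβ hS (neg_mem_ball hx), Finset.sum_filter]
    simp only [Set.indicator_apply, sub_eq_add_neg]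
  have hsplit := Finset.sum_filter_add_sum_filter_not (grid S β n) (fun y => y - x ∈ ball β r)
    (fun y => density S β χ α n s (y - x))
  rw [hmass, hball] at hsplit
  have hge := hχ.sum_ballGrid_density_ge (s := s) hβ hS hα.le hs hr hrn
  linarith

omit [IsUltrametricDist K] in
lemma summable_pow_mul_exp_neg_mul_pow {q b : ℝ} (hq : 0 < q) (hs : 0 < s) (hb : 1 < b) :
    Summable fun j : ℕ => q ^ j * Real.exp (-s * b ^ j) := by
  have hratio : ∀ j : ℕ, ‖q ^ (j + 1) * Real.exp (-s * b ^ (j + 1))‖ /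
      ‖q ^ j * Real.exp (-s * b ^ j)‖ = q * Real.exp (-(b ^ j * (s * (b - 1)))) := by
    intro j
    rw [Real.norm_of_nonneg (by positivity), Real.norm_of_nonneg (by positivity),
      mul_div_mul_comm, ← Real.exp_sub, pow_succ, mul_div_cancel_left₀ _ (by positivity)]
    ring_nf
  refine summable_of_ratio_test_tendsto_lt_one zero_lt_one
    (Eventually.of_forall fun j => by positivity) ?_
  simp_rw [hratio]
  have hgrowth : Tendsto (fun j : ℕ => b ^ j * (s * (b - 1))) atTop atTop :=
    (tendsto_pow_atTop_atTop_of_one_lt hb).atTop_mul_const (mul_pos hs (sub_pos.2 hb))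
  simpa using (Real.tendsto_exp_neg_atTop_nhds_zero.comp hgrowth).const_mul q

omit [IsUltrametricDist K] in
lemma IsUniformizer.apply_norm_le_sum_indicator (hβ : IsUniformizer β) {g : ℝ → ℝ}
    (hg : AntitoneOn g (Ici 0)) (hg_nonneg : ∀ y, 0 ≤ y → 0 ≤ g y) (hx : x ∈ ball β n) :
    g ‖x‖ ≤ (ball β 0).indicator (fun _ => g 0) x +
      ∑ j ∈ Finset.range (n + 1), (ball β j).indicator (fun _ => g (‖β‖ ^ (-(j : ℤ)))) x := by
  have hterm : ∀ j ∈ Finset.range (n + 1),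
      0 ≤ (ball β j).indicator (fun _ => g (‖β‖ ^ (-(j : ℤ)))) x := fun j _ =>
    Set.indicator_nonneg (fun _ _ => hg_nonneg _ (zpow_pos hβ.norm_pos _).le) x
  by_cases hx0 : x ∈ ball β 0
  · rw [Set.indicator_of_mem hx0]
    exact (hg self_mem_Ici (norm_nonneg x) (norm_nonneg x)).trans
      (le_add_of_nonneg_right (Finset.sum_nonneg hterm))
  · obtain ⟨m, hm⟩ := hβ.exists_norm_eq (x := x) fun h => hx0 (h ▸ zero_mem_ball β 0)
    rw [hβ.mem_ball_iff, hm, zpow_le_zpow_iff_right_of_lt_one₀ hβ.norm_pos hβ.norm_lt_one] at hx hx0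
    lift m to ℕ using by lia
    have hmem : x ∈ ball β m := hβ.mem_ball_iff.2 hm.le
    rw [Set.indicator_of_notMem (by rwa [hβ.mem_ball_iff, hm,
      zpow_le_zpow_iff_right_of_lt_one₀ hβ.norm_pos hβ.norm_lt_one]), zero_add]
    calc g ‖x‖ = (ball β m).indicator (fun _ => g (‖β‖ ^ (-(m : ℤ)))) x := by
          rw [Set.indicator_of_mem hmem, hm]
      _ ≤ _ := Finset.single_le_sum hterm (Finset.mem_range.2 (by lia))

theorem IsUniformizer.sum_grid_antitone_le (hβ : IsUniformizer β) (hS : IsDigitSet S) {g : ℝ → ℝ}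
    (hg : AntitoneOn g (Ici 0)) (hg_nonneg : ∀ y, 0 ≤ y → 0 ≤ g y) :
    ∑ ξ ∈ grid S β n, g ‖ξ‖ ≤ (S.card : ℝ) ^ n *
      (g 0 + ∑ j ∈ Finset.range (n + 1), (S.card : ℝ) ^ j * g (‖β‖ ^ (-(j : ℤ)))) := by
  have hball : ∀ j : ℕ, j ≤ n → ∀ c : ℝ, ∑ ξ ∈ grid S β n, (ball β j).indicator (fun _ => c) ξ =
      (S.card : ℝ) ^ n * ((S.card : ℝ) ^ j * c) := by
    intro j hj c
    rw [← sum_ballGrid_eq_sum_indicator, Finset.sum_const, nsmul_eq_mul,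
      hβ.card_ballGrid hS (by lia) (by lia), zpow_add₀ hS.card_pos.ne', zpow_natCast, zpow_natCast,
      mul_assoc]
  calc ∑ ξ ∈ grid S β n, g ‖ξ‖
    _ ≤ ∑ ξ ∈ grid S β n, ((ball β 0).indicator (fun _ => g 0) ξ + ∑ j ∈ Finset.range (n + 1),
        (ball β j).indicator (fun _ => g (‖β‖ ^ (-(j : ℤ)))) ξ) :=
      Finset.sum_le_sum fun ξ hξ =>
        hβ.apply_norm_le_sum_indicator hg hg_nonneg (hβ.mem_ball_of_mem_grid hS hξ)
    _ = (S.card : ℝ) ^ n *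
        (g 0 + ∑ j ∈ Finset.range (n + 1), (S.card : ℝ) ^ j * g (‖β‖ ^ (-(j : ℤ)))) := by
      rw [Finset.sum_add_distrib, Finset.sum_comm, mul_add, Finset.mul_sum]
      congr 1
      · simpa using hball 0 n.zero_le (g 0)
      · exact Finset.sum_congr rfl fun j hj => hball j (Finset.mem_range_succ_iff.1 hj) _

theorem IsUniformizer.exists_density_zero_le (hβ : IsUniformizer β) (hS : IsDigitSet S)
    (χ : AddChar K Circle) (hα : 0 < α) (hs : 0 < s) :
    ∃ C : ℝ, ∀ n : ℕ, density S β χ α n s 0 ≤ C := by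
  have hb : 1 < ‖β‖ ^ (-α) :=
    Real.one_lt_rpow_of_pos_of_lt_one_of_neg hβ.norm_pos hβ.norm_lt_one (neg_lt_zero.2 hα)
  have hpow : ∀ j : ℕ, (‖β‖ ^ (-(j : ℤ))) ^ α = (‖β‖ ^ (-α)) ^ j := by
    intro j
    rw [← Real.rpow_intCast, ← Real.rpow_mul hβ.norm_pos.le, ← Real.rpow_mul_natCast hβ.norm_pos.le]
    push_cast
    ring_nf
  refine ⟨1 + ∑' j : ℕ, (S.card : ℝ) ^ j * Real.exp (-s * (‖β‖ ^ (-α)) ^ j), fun n => ?_⟩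
  have hsum := hβ.sum_grid_antitone_le hS (n := n) (antitoneOn_exp_neg_mul_rpow hα.le hs.le)
    fun y _ => (Real.exp_pos _).le
  simp only [Real.zero_rpow hα.ne', mul_zero, Real.exp_zero, hpow] at hsum
  rw [density_zero, inv_mul_le_iff₀ (pow_pos hS.card_pos n)]
  refine hsum.trans ?_
  gcongr
  exact (summable_pow_mul_exp_neg_mul_pow hS.card_pos hs hb).sum_le_tsum _
    fun j _ => by positivity

end Density

section Uniqueness

variable {K : Type*} [NontriviallyNormedField K] [MeasurableSpace K] {β : K} {S : Finset K}
  {χ : AddChar K Circle} {α : ℝ} {n : ℕ} {t : ℝ} {a : K}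

lemma measurable_eval_skorokhod (s : Icc (0 : ℝ) t) :
    Measurable fun ω : SkorokhodSpace K t => ω.1 s :=
  (measurable_pi_apply s).comp measurable_subtype_coe

lemma measurableSet_forall_eval_mem {ι : Type*} [Countable ι] (τ : ι → Icc (0 : ℝ) t)
    {J : ι → Set K} (hJ : ∀ i, MeasurableSet (J i)) :
    MeasurableSet {ω : SkorokhodSpace K t | ∀ i, ω.1 (τ i) ∈ J i} := by
  rw [ofPred_forall]
  exact MeasurableSet.iInter fun i => measurable_eval_skorokhod (τ i) (hJ i)

omit [MeasurableSpace K] in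
lemma SkorokhodSpace.preimage_pi (I : Finset (Icc (0 : ℝ) t)) (J : Icc (0 : ℝ) t → Set K) :
    (Subtype.val : SkorokhodSpace K t → Icc (0 : ℝ) t → K) ⁻¹' (I : Set (Icc (0 : ℝ) t)).pi J =
      {ω | ∀ i, ω.1 (I.orderEmbOfFin rfl i) ∈ J (I.orderEmbOfFin rfl i)} := by
  ext ω
  simp only [mem_preimage, Set.mem_pi, mem_ofPred_eq, ← I.range_orderEmbOfFin rfl,
    forall_mem_range]

theorem IsPathMeasure.unique {P Q : Measure (SkorokhodSpace K t)}
    (hP : IsPathMeasure S β χ α n t a P) (hQ : IsPathMeasure S β χ α n t a Q) : P = Q := by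
  have := hP.1
  have := hQ.1
  have hval : Measurable (Subtype.val : SkorokhodSpace K t → Icc (0 : ℝ) t → K) :=
    measurable_subtype_coe
  have hmap : P.map Subtype.val = Q.map Subtype.val := by
    have := Measure.isProbabilityMeasure_map (μ := P) hval.aemeasurable
    refine ext_of_generate_finite _ generateFrom_squareCylinders.symm
      (isPiSystem_squareCylinders (fun _ => MeasurableSpace.isPiSystem_measurableSet)
        fun _ => MeasurableSet.univ) ?_ ?_
    · rintro - ⟨I, J, hJ, rfl⟩
      simp only [mem_univ_pi, mem_ofPred_eq] at hJ
      have hm : MeasurableSet ((I : Set (Icc (0 : ℝ) t)).pi J) :=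
        MeasurableSet.pi I.countable_toSet fun i _ => hJ i
      rw [Measure.map_apply hval hm, Measure.map_apply hval hm, SkorokhodSpace.preimage_pi,
        ← measureReal_eq_measureReal_iff,
        hP.2 _ _ _ (I.orderEmbOfFin rfl).strictMono fun i => hJ _,
        hQ.2 _ _ _ (I.orderEmbOfFin rfl).strictMono fun i => hJ _]
    · rw [Measure.map_apply hval MeasurableSet.univ, Measure.map_apply hval MeasurableSet.univ]
      simp only [preimage_univ, measure_univ]
  ext A ⟨B, hB, hBA⟩
  rw [← hBA, ← Measure.map_apply hval hB, ← Measure.map_apply hval hB, hmap]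

end Uniqueness

section Poisson

variable {X : Type*} [MeasurableSpace X]

/-- The law of the points of a Poisson process with intensity `μ`, listed in random order: their
number has the Poisson distribution with parameter `μ univ`, and given their number they are
independent with law proportional to `μ`. -/
def poissonLaw (μ : Measure X) : Measure (Σ m : ℕ, Fin m → X) :=
  Measure.sum fun m => ENNReal.ofReal (Real.exp (-μ.real univ) / m.factorial) •
    (Measure.pi fun _ : Fin m => μ).map (Sigma.mk m)

lemma measurable_sigma {ι Y : Type*} {Z : ι → Type*} [∀ i, MeasurableSpace (Z i)]
    [MeasurableSpace Y] {f : (Σ i, Z i) → Y} (hf : ∀ i, Measurable fun z => f ⟨i, z⟩) :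
    Measurable f := fun _ hA =>
  MeasurableSpace.measurableSet_iInf.2 fun i => hf i hA

lemma measurable_sigmaMk {ι : Type*} {Z : ι → Type*} [∀ i, MeasurableSpace (Z i)] (i : ι) :
    Measurable (Sigma.mk i : Z i → Σ i, Z i) := fun _ hA =>
  MeasurableSpace.measurableSet_iInf.1 hA i

lemma measurable_prod_config {g : X → ℂ} (hg : Measurable g) :
    Measurable fun w : Σ m, Fin m → X => ∏ i, g (w.2 i) := by
  refine measurable_sigma fun m => ?_
  change Measurable fun z : Fin m → X => ∏ i, g (z i)
  fun_prop

variable {μ : Measure X} [IsFiniteMeasure μ]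

instance : IsProbabilityMeasure (poissonLaw μ) := by
  have hexp := ((NormedSpace.expSeries_div_hasSum_exp (μ.real univ)).mul_left
    (Real.exp (-μ.real univ)))
  rw [← Real.exp_eq_exp_ℝ, ← Real.exp_add, neg_add_cancel, Real.exp_zero] at hexp
  refine ⟨?_⟩
  have hterm (m : ℕ) : (ENNReal.ofReal (Real.exp (-μ.real univ) / m.factorial) •
      (Measure.pi fun _ : Fin m => μ).map (Sigma.mk (β := fun m => Fin m → X) m)) univ =
      ENNReal.ofReal (Real.exp (-μ.real univ) * (μ.real univ ^ m / m.factorial)) := by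
    rw [Measure.smul_apply, Measure.map_apply (measurable_sigmaMk (Z := fun m => Fin m → X) m)
      MeasurableSet.univ, preimage_univ, Measure.pi_univ, Finset.prod_const, Finset.card_univ,
      Fintype.card_fin, ← ofReal_measureReal, ← ENNReal.ofReal_pow measureReal_nonneg, smul_eq_mul,
      ← ENNReal.ofReal_mul (by positivity), div_mul_eq_mul_div, mul_div_assoc]
  rw [poissonLaw, Measure.sum_apply _ MeasurableSet.univ, tsum_congr hterm,
    ← ENNReal.ofReal_tsum_of_nonneg (fun m => by positivity) hexp.summable, hexp.tsum_eq,
    ENNReal.ofReal_one]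

variable {g : X → ℂ}

lemma integrable_prod_poissonLaw (hg : Measurable g) (hg_le : ∀ x, ‖g x‖ ≤ 1) :
    Integrable (fun w : Σ m, Fin m → X => ∏ i, g (w.2 i)) (poissonLaw μ) := by
  refine (integrable_const (1 : ℝ)).mono' (measurable_prod_config hg).aestronglyMeasurable
    (ae_of_all _ fun w => ?_)
  rw [norm_prod]
  exact Finset.prod_le_one (fun _ _ => norm_nonneg _) fun i _ => hg_le _

/-- Campbell's formula for multiplicative functionals. -/
theorem integral_prod_poissonLaw (hg : Measurable g) (hg_le : ∀ x, ‖g x‖ ≤ 1) :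
    ∫ w : Σ m, Fin m → X, ∏ i, g (w.2 i) ∂poissonLaw μ =
      Complex.exp (∫ x, (g x - 1) ∂μ) := by
  have hg_int : Integrable g μ := (integrable_const (1 : ℝ)).mono' hg.aestronglyMeasurable
    (ae_of_all _ hg_le)
  have hterm (m : ℕ) : ∫ w : Σ m, Fin m → X, ∏ i, g (w.2 i)
      ∂(ENNReal.ofReal (Real.exp (-μ.real univ) / m.factorial) •
        (Measure.pi fun _ : Fin m => μ).map (Sigma.mk m)) =
      Complex.exp (-μ.real univ) * ((∫ x, g x ∂μ) ^ m / m.factorial) := by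
    rw [integral_smul_measure, integral_map (measurable_sigmaMk m).aemeasurable
      (measurable_prod_config hg).aestronglyMeasurable, ENNReal.toReal_ofReal (by positivity),
      integral_fintype_prod_eq_pow, Fintype.card_fin, Complex.real_smul]
    push_cast
    ring
  rw [integral_sub hg_int (integrable_const 1), integral_const, Complex.real_smul, mul_one,
    sub_eq_neg_add, Complex.exp_add, poissonLaw,
    integral_sum_measure (integrable_prod_poissonLaw hg hg_le), tsum_congr hterm, tsum_mul_left,
    Complex.exp_eq_exp_ℂ, (NormedSpace.expSeries_div_hasSum_exp (∫ x, g x ∂μ)).tsum_eq]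

end Poisson

section Walk

lemma eventually_setOf_le_eq_setOf_lt {T ι : Type*} [LinearOrder T] [TopologicalSpace T]
    [OrderTopology T] [Finite ι] (u : ι → T) (s : T) :
    ∀ᶠ r in 𝓝[<] s, {i | u i ≤ r} = {i | u i < s} := by
  have hiff (i : ι) : ∀ᶠ r in 𝓝[<] s, u i ≤ r ↔ u i < s := by
    by_cases hi : u i < s
    · filter_upwards [nhdsWithin_le_nhds (eventually_gt_nhds hi)] with r hr
      exact iff_of_true hr.le hi
    · filter_upwards [self_mem_nhdsWithin] with r hr
      exact iff_of_false (not_le.2 (lt_of_lt_of_le hr (not_lt.1 hi))) hi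
  filter_upwards [eventually_all.2 hiff] with r hr
  exact Set.ext hr

lemma eventually_setOf_le_eq {T ι : Type*} [LinearOrder T] [TopologicalSpace T]
    [OrderTopology T] [Finite ι] (u : ι → T) (s : T) :
    ∀ᶠ r in 𝓝[>] s, {i | u i ≤ r} = {i | u i ≤ s} := by
  have hiff (i : ι) : ∀ᶠ r in 𝓝[>] s, u i ≤ r ↔ u i ≤ s := by
    by_cases hi : u i ≤ s
    · filter_upwards [self_mem_nhdsWithin] with r hr
      exact iff_of_true (hi.trans (le_of_lt hr)) hi
    · filter_upwards [nhdsWithin_le_nhds (eventually_lt_nhds (not_le.1 hi))] with r hr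
      exact iff_of_false (not_le.2 hr) hi
  filter_upwards [eventually_all.2 hiff] with r hr
  exact Set.ext hr

variable {K : Type*} [NontriviallyNormedField K] {β : K} {S : Finset K} {n : ℕ} {t : ℝ} {a : K}

lemma isSkorokhod_setOf_le {ι : Type*} [Finite ι] (u : ι → Ioo (0 : ℝ) t) (F : Set ι → K) :
    IsSkorokhod fun s : Icc (0 : ℝ) t => F {i | (u i : ℝ) ≤ s} := by
  let u' : ι → Icc (0 : ℝ) t := fun i => Set.inclusion Ioo_subset_Icc_self (u i)
  have hleft (s : Icc (0 : ℝ) t) : Tendsto (fun r : Icc (0 : ℝ) t => F {i | u' i ≤ r}) (𝓝[<] s)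
      (𝓝 (F {i | u' i < s})) :=
    tendsto_const_nhds.congr' <|
      (eventually_setOf_le_eq_setOf_lt u' s).mono fun r hr => (congrArg F hr).symm
  refine ⟨fun s => ?_, fun s => ⟨_, hleft s⟩, fun s hs => ?_⟩
  · exact tendsto_const_nhds.congr' <|
      (eventually_setOf_le_eq u' s).mono fun r hr => (congrArg F hr).symm
  · have hall : {i | (u i : ℝ) ≤ s} = {i | u' i < s} := by
      ext i
      have hi : (u i : ℝ) < s := hs.symm ▸ (u i).2.2
      exact iff_of_true hi.le hi
    have hlim := hleft s
    rwa [← hall] at hlim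

/-- A finite list of jump times in `(0, t)`, each with a jump in the grid; the list need not be
sorted by time. -/
abbrev JumpConfig (S : Finset K) (β : K) (n : ℕ) (t : ℝ) : Type _ :=
  Σ m : ℕ, Fin m → Ioo (0 : ℝ) t × grid S β n

/-- The position at time `s` of the walk in `K` which starts at `a` and makes the jumps `w`. -/
def walk (a : K) (w : JumpConfig S β n t) (s : ℝ) : K :=
  a + ∑ i, if ((w.2 i).1 : ℝ) ≤ s then ((w.2 i).2 : K) else 0

lemma walk_zero (a : K) (w : JumpConfig S β n t) : walk a w 0 = a := by
  rw [walk, Finset.sum_eq_zero fun i _ => if_neg (not_le.2 (w.2 i).1.2.1), add_zero]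

lemma walk_sub_walk (a : K) (w : JumpConfig S β n t) {r s : ℝ} (hrs : r ≤ s) :
    walk a w s - walk a w r =
      ∑ i, if ((w.2 i).1 : ℝ) ∈ Ioc r s then ((w.2 i).2 : K) else 0 := by
  rw [walk, walk, add_sub_add_left_eq_sub, ← Finset.sum_sub_distrib]
  refine Finset.sum_congr rfl fun i _ => ?_
  by_cases hr : ((w.2 i).1 : ℝ) ≤ r
  · simp [hr, hr.trans hrs, not_lt.2 hr]
  · simp [hr, not_le.1 hr]

/-- The walk with jumps `w`, moved to the grid modulo `ball β (-n)`, as a Skorokhod path. -/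
def jumpPath (a : K) (w : JumpConfig S β n t) : SkorokhodSpace K t :=
  ⟨fun s => gridRep S β n (walk a w s), by
    classical
    exact isSkorokhod_setOf_le (fun i => (w.2 i).1)
      fun A => gridRep S β n (a + ∑ i, if i ∈ A then ((w.2 i).2 : K) else 0)⟩

lemma measurable_comp_walk [MeasurableSpace K] [MeasurableSingletonClass K] (hS : IsDigitSet S)
    {ι Y : Type*} [Finite ι] [MeasurableSpace Y] (s : ι → ℝ) (f : (ι → K) → Y) :
    Measurable fun w : JumpConfig S β n t => f fun j => walk a w (s j) := by
  refine measurable_sigma fun m => ?_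
  let jumps (w : Fin m → Ioo (0 : ℝ) t × grid S β n) (j : ι) (i : Fin m) : grid S β n :=
    if ((w i).1 : ℝ) ≤ s j then (w i).2 else ⟨0, hS.zero_mem_grid⟩
  have hjumps : Measurable jumps := by
    refine measurable_pi_lambda _ fun j => measurable_pi_lambda _ fun i =>
      Measurable.ite ?_ (by fun_prop) measurable_const
    exact measurableSet_le (by fun_prop) measurable_const
  have hsum : Measurable fun y : ι → Fin m → grid S β n => f fun j => a + ∑ i, (y j i : K) :=
    measurable_of_countable _
  convert hsum.comp hjumps using 4 with w j
  simp only [walk, jumps, Function.comp_apply, apply_ite Subtype.val]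

lemma measurable_jumpPath [MeasurableSpace K] [MeasurableSingletonClass K] (hS : IsDigitSet S) :
    Measurable (jumpPath a : JumpConfig S β n t → SkorokhodSpace K t) := by
  refine Measurable.subtype_mk (measurable_pi_lambda _ fun s => ?_)
  exact measurable_comp_walk hS (fun _ : Unit => (s : ℝ)) fun x => gridRep S β n (x ())

variable [IsUltrametricDist K]

lemma IsUniformizer.walk_mem_ball (hβ : IsUniformizer β) (hS : IsDigitSet S) (ha : a ∈ grid S β n)
    (w : JumpConfig S β n t) (s : ℝ) : walk a w s ∈ ball β n := by
  refine add_mem_ball (hβ.mem_ball_of_mem_grid hS ha) (sum_mem_ball fun i _ => ?_)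
  split_ifs
  · exact hβ.mem_ball_of_mem_grid hS (w.2 i).2.2
  · exact zero_mem_ball β n

lemma IsUniformizer.jumpPath_eq_iff (hβ : IsUniformizer β) (hS : IsDigitSet S)
    (w : JumpConfig S β n t) {N : ℕ} {σ : Fin (N + 1) → Icc (0 : ℝ) t} (hσ : (σ 0 : ℝ) = 0)
    {b : Fin (N + 1) → K} (hb : ∀ j, b j ∈ grid S β n) :
    (∀ j : Fin N, (jumpPath (b 0) w).1 (σ j.succ) = b j.succ) ↔
      ∀ j : Fin N, b j.succ - b j.castSucc -
        (walk (b 0) w (σ j.succ) - walk (b 0) w (σ j.castSucc)) ∈ ball β (-n) := by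
  have hzero : walk (b 0) w (σ 0) - b 0 ∈ ball β (-n) := by
    rw [hσ, walk_zero, sub_self]
    exact zero_mem_ball β _
  calc (∀ j : Fin N, (jumpPath (b 0) w).1 (σ j.succ) = b j.succ)
    _ ↔ ∀ j : Fin N, walk (b 0) w (σ j.succ) - b j.succ ∈ ball β (-n) :=
        forall_congr' fun j => hβ.gridRep_eq_iff hS (hβ.walk_mem_ball hS (hb 0) w _) (hb _)
    _ ↔ ∀ k : Fin (N + 1), walk (b 0) w (σ k) - b k ∈ ball β (-n) := by
        rw [Fin.forall_fin_succ, and_iff_right hzero]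
    _ ↔ _ := ⟨fun h j => ?_, fun h k => ?_⟩
  · convert sub_mem_ball (h j.castSucc) (h j.succ) using 1
    ring
  · induction k using Fin.induction with
    | zero => exact hzero
    | succ j ih =>
      convert sub_mem_ball ih (h j) using 1
      ring

end Walk

section JumpLaw

variable {K : Type*} [NontriviallyNormedField K] {β : K} {S : Finset K} {χ : AddChar K Circle}
  {α : ℝ} {n : ℕ} {t : ℝ}

/-- The total jump rate of the walk on the grid: the largest value of `‖·‖ ^ α` on `ball β n`. -/
def jumpRate (β : K) (α : ℝ) (n : ℕ) : ℝ := (‖β‖ ^ (-(n : ℤ))) ^ α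

/-- The rate of jumps by `y`. It is chosen such that its Fourier transform is
`jumpRate β α n - ‖·‖ ^ α`, and it is nonnegative because this function is radially decreasing. -/
def jumpWeight (S : Finset K) (β : K) (χ : AddChar K Circle) (α : ℝ) (n : ℕ) (y : K) : ℝ :=
  ((S.card : ℝ) ^ n)⁻¹ *
    (finiteFourierInv S β χ n (fun ξ => (jumpRate β α n - ‖ξ‖ ^ α : ℝ)) y).re

/-- The jump measure of the walk on the grid. -/
def jumpLaw [MeasurableSpace K] (S : Finset K) (β : K) (χ : AddChar K Circle) (α : ℝ) (n : ℕ) :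
    Measure (grid S β n) :=
  ∑ y : grid S β n, ENNReal.ofReal (jumpWeight S β χ α n y) • Measure.dirac y

instance [MeasurableSpace K] : IsFiniteMeasure (jumpLaw S β χ α n) := by
  refine ⟨?_⟩
  simp only [jumpLaw, Measure.coe_finsetSum, Finset.sum_apply, Measure.smul_apply,
    measure_univ, smul_eq_mul, mul_one]
  exact ENNReal.sum_lt_top.2 fun y _ => ENNReal.ofReal_lt_top

/-- Lebesgue measure on the interval `(0, t)` as a type. -/
def jumpTimeMeasure (t : ℝ) : Measure (Ioo (0 : ℝ) t) := volume.comap Subtype.val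

lemma jumpTimeMeasure_apply (A : Set (Ioo (0 : ℝ) t)) :
    jumpTimeMeasure t A = volume (Subtype.val '' A) :=
  comap_subtype_coe_apply measurableSet_Ioo volume A

instance : IsFiniteMeasure (jumpTimeMeasure t) :=
  ⟨by simp only [jumpTimeMeasure_apply, image_univ, Subtype.range_coe, measure_Ioo_lt_top]⟩

lemma jumpTimeMeasure_real_preimage_Ioc {r s : ℝ} (hr : 0 ≤ r) (hrs : r ≤ s) (hs : s ≤ t) :
    (jumpTimeMeasure t).real (Subtype.val ⁻¹' Ioc r s) = s - r := by
  have hIoo : Ioo r s ⊆ Ioo 0 t ∩ Ioc r s := fun x hx =>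
    ⟨⟨hr.trans_lt hx.1, hx.2.trans_le hs⟩, Ioo_subset_Ioc_self hx⟩
  have hvol : volume (Ioo 0 t ∩ Ioc r s) = ENNReal.ofReal (s - r) :=
    le_antisymm (Real.volume_Ioc (a := r) (b := s) ▸ measure_mono inter_subset_right)
      (Real.volume_Ioo (a := r) (b := s) ▸ measure_mono hIoo)
  rw [measureReal_def, jumpTimeMeasure_apply, Subtype.image_preimage_coe, hvol,
    ENNReal.toReal_ofReal (sub_nonneg.2 hrs)]

/-- The intensity of jump times and jumps. -/
def jumpIntensity [MeasurableSpace K] (S : Finset K) (β : K) (χ : AddChar K Circle) (α : ℝ) (n : ℕ)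
    (t : ℝ) : Measure (Ioo (0 : ℝ) t × grid S β n) :=
  (jumpTimeMeasure t).prod (jumpLaw S β χ α n)

instance [MeasurableSpace K] : IsFiniteMeasure (jumpIntensity S β χ α n t) :=
  inferInstanceAs (IsFiniteMeasure ((jumpTimeMeasure t).prod (jumpLaw S β χ α n)))

lemma antitoneOn_jumpRate_sub_rpow (hα : 0 ≤ α) :
    AntitoneOn (fun y : ℝ => jumpRate β α n - y ^ α) (Ici 0) := fun _ hx _ _ hxy =>
  sub_le_sub_left (Real.rpow_le_rpow hx hxy hα) _

variable [IsUltrametricDist K] {y ξ : K}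

open scoped ComplexOrder in
lemma IsRankZeroCharacter.finiteFourierInv_jumpRate_nonneg (hχ : IsRankZeroCharacter β χ)
    (hβ : IsUniformizer β) (hS : IsDigitSet S) (hα : 0 ≤ α) (hy : y ∈ ball β n) :
    0 ≤ finiteFourierInv S β χ n (fun ξ => (jumpRate β α n - ‖ξ‖ ^ α : ℝ)) y :=
  hχ.finiteFourierInv_nonneg hβ hS hy (g := fun y => jumpRate β α n - y ^ α)
    (antitoneOn_jumpRate_sub_rpow hα) (sub_self _).ge

lemma IsRankZeroCharacter.jumpWeight_nonneg (hχ : IsRankZeroCharacter β χ)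
    (hβ : IsUniformizer β) (hS : IsDigitSet S) (hα : 0 ≤ α) (hy : y ∈ ball β n) :
    0 ≤ jumpWeight S β χ α n y :=
  mul_nonneg (by positivity)
    (Complex.le_def.1 (hχ.finiteFourierInv_jumpRate_nonneg hβ hS hα hy)).1

lemma IsRankZeroCharacter.ofReal_jumpWeight (hχ : IsRankZeroCharacter β χ)
    (hβ : IsUniformizer β) (hS : IsDigitSet S) (hα : 0 ≤ α) (hy : y ∈ ball β n) :
    (jumpWeight S β χ α n y : ℂ) = ((S.card : ℂ) ^ n * (S.card : ℂ) ^ n)⁻¹ *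
      ∑ ξ ∈ grid S β n, ((jumpRate β α n - ‖ξ‖ ^ α : ℝ) : ℂ) * (χ (y * ξ) : ℂ) := by
  have hre : ((finiteFourierInv S β χ n (fun ξ => (jumpRate β α n - ‖ξ‖ ^ α : ℝ)) y).re : ℂ) =
      finiteFourierInv S β χ n (fun ξ => (jumpRate β α n - ‖ξ‖ ^ α : ℝ)) y :=
    Complex.ext rfl (Complex.le_def.1 (hχ.finiteFourierInv_jumpRate_nonneg hβ hS hα hy)).2
  rw [jumpWeight, Complex.ofReal_mul, hre, finiteFourierInv, mul_inv, mul_assoc]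
  simp only [Complex.ofReal_inv, Complex.ofReal_pow, Complex.ofReal_natCast]

lemma IsRankZeroCharacter.sum_grid_fourier_inversion (hχ : IsRankZeroCharacter β χ)
    (hβ : IsUniformizer β) (hS : IsDigitSet S) (f : K → ℂ) (hξ : ξ ∈ grid S β n) :
    ∑ y ∈ grid S β n, (∑ η ∈ grid S β n, f η * (χ (y * η) : ℂ)) * (χ (-(y * ξ)) : ℂ) =
      (S.card : ℂ) ^ n * (S.card : ℂ) ^ n * f ξ := by
  have hchar (y η : K) : (χ (y * η) : ℂ) * (χ (-(y * ξ)) : ℂ) = (χ ((η - ξ) * y) : ℂ) := by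
    rw [← Circle.coe_mul, ← AddChar.map_add_eq_mul]
    ring_nf
  calc ∑ y ∈ grid S β n, (∑ η ∈ grid S β n, f η * (χ (y * η) : ℂ)) * (χ (-(y * ξ)) : ℂ)
    _ = ∑ η ∈ grid S β n, f η * ∑ y ∈ grid S β n, (χ ((η - ξ) * y) : ℂ) := by
        simp only [Finset.sum_mul, Finset.mul_sum, mul_assoc, hchar]
        rw [Finset.sum_comm]
    _ = f ξ * ∑ y ∈ grid S β n, (χ ((ξ - ξ) * y) : ℂ) := by
        refine Finset.sum_eq_single ξ (fun η hη hηξ => ?_) fun h => absurd hξ h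
        rw [hχ.sum_grid_apply_mul hβ hS (hβ.sub_mem_ball_of_mem_grid hS hη hξ), indicator_of_notMem
          fun h => hηξ (hβ.eq_of_sub_mem_ball hS hη hξ h), mul_zero]
    _ = _ := by
        rw [sub_self, hχ.sum_grid_apply_mul hβ hS (zero_mem_ball β _),
          indicator_of_mem (zero_mem_ball β _), mul_comm]

variable [MeasurableSpace K] [MeasurableSingletonClass K]

lemma IsRankZeroCharacter.integral_jumpLaw (hχ : IsRankZeroCharacter β χ) (hβ : IsUniformizer β)
    (hS : IsDigitSet S) (hα : 0 ≤ α) (hξ : ξ ∈ grid S β n) :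
    ∫ y : grid S β n, (χ (-(y * ξ)) : ℂ) ∂jumpLaw S β χ α n =
      ((jumpRate β α n - ‖ξ‖ ^ α : ℝ) : ℂ) := by
  have hq : (S.card : ℂ) ^ n * (S.card : ℂ) ^ n ≠ 0 := by
    have := hS.card_pos.ne'
    norm_cast at this ⊢
    positivity
  have hdirac (y : grid S β n) : ∫ y : grid S β n, (χ (-(y * ξ)) : ℂ)
      ∂(ENNReal.ofReal (jumpWeight S β χ α n y) • Measure.dirac y) =
      jumpWeight S β χ α n y * (χ (-(y * ξ)) : ℂ) := by
    rw [integral_smul_measure, integral_dirac, ENNReal.toReal_ofReal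
      (hχ.jumpWeight_nonneg hβ hS hα (hβ.mem_ball_of_mem_grid hS y.2)), Complex.real_smul]
  rw [jumpLaw, integral_finsetSum_measure fun _ _ =>
      (integrable_dirac enorm_lt_top).smul_measure ENNReal.ofReal_ne_top,
    Finset.sum_congr rfl fun y _ => hdirac y,
    Finset.sum_coe_sort _ fun y => (jumpWeight S β χ α n y : ℂ) * (χ (-(y * ξ)) : ℂ),
    ← inv_mul_cancel_left₀ hq (((jumpRate β α n - ‖ξ‖ ^ α : ℝ) : ℂ)),
    ← hχ.sum_grid_fourier_inversion hβ hS (fun ξ => ((jumpRate β α n - ‖ξ‖ ^ α : ℝ) : ℂ)) hξ,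
    Finset.mul_sum]
  refine Finset.sum_congr rfl fun y hy => ?_
  rw [hχ.ofReal_jumpWeight hβ hS hα (hβ.mem_ball_of_mem_grid hS hy), mul_assoc]

lemma IsRankZeroCharacter.jumpLaw_real_univ (hχ : IsRankZeroCharacter β χ) (hβ : IsUniformizer β)
    (hS : IsDigitSet S) (hα : 0 < α) : (jumpLaw S β χ α n).real univ = jumpRate β α n := by
  have h := hχ.integral_jumpLaw hβ hS hα.le (hS.zero_mem_grid (β := β) (n := n))
  simp only [mul_zero, neg_zero, AddChar.map_zero_eq_one, Circle.coe_one, integral_const,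
    norm_zero, Real.zero_rpow hα.ne', sub_zero, Complex.real_smul, mul_one] at h
  exact_mod_cast h

end JumpLaw

section Increments

lemma prod_ite_one_sub_one {X ι R : Type*} [CommRing R] {A : ι → Set X} [∀ i x, Decidable (x ∈ A i)]
    (hA : Pairwise (Function.onFun Disjoint A)) (s : Finset ι) (f : ι → R) (x : X) :
    (∏ i ∈ s, if x ∈ A i then f i else 1) - 1 = ∑ i ∈ s, if x ∈ A i then f i - 1 else 0 := by
  by_cases hx : ∃ j ∈ s, x ∈ A j
  · obtain ⟨j, hj, hxj⟩ := hx
    have hne (i : ι) (hij : i ≠ j) : x ∉ A i := fun hxi => (hA hij).le_bot ⟨hxi, hxj⟩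
    rw [Finset.prod_eq_single_of_mem j hj fun i _ hij => if_neg (hne i hij),
      Finset.sum_eq_single_of_mem j hj fun i _ hij => if_neg (hne i hij), if_pos hxj, if_pos hxj]
  · push Not at hx
    rw [Finset.prod_eq_one fun i hi => if_neg (hx i hi),
      Finset.sum_eq_zero fun i hi => if_neg (hx i hi), sub_self]

lemma pairwise_disjoint_Ioc_castSucc_succ {T : Type*} [Preorder T] {N : ℕ} {σ : Fin (N + 1) → T}
    (hσ : Monotone σ) :
    Pairwise (Function.onFun Disjoint fun j : Fin N => Ioc (σ j.castSucc) (σ j.succ)) := by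
  intro i j hij
  wlog hlt : i < j generalizing i j
  · exact (this hij.symm (lt_of_le_of_ne (not_lt.1 hlt) hij.symm)).symm
  exact Set.disjoint_left.2 fun x hx hx' =>
    (hx'.1.trans_le (hx.2.trans (hσ (Fin.succ_le_castSucc_iff.2 hlt)))).false

lemma coe_addChar_sum {A ι : Type*} [AddCommMonoid A] (ψ : AddChar A Circle) (s : Finset ι)
    (f : ι → A) : (ψ (∑ i ∈ s, f i) : ℂ) = ∏ i ∈ s, (ψ (f i) : ℂ) :=
  map_prod (Circle.coeHom.comp ψ.toMonoidHom) (fun i => Multiplicative.ofAdd (f i)) s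

variable {K : Type*} [NontriviallyNormedField K] {β : K} {S : Finset K} {χ : AddChar K Circle}
  {α : ℝ} {n : ℕ} {t : ℝ} {N : ℕ} {σ : Fin (N + 1) → Icc (0 : ℝ) t} {ξ : Fin N → K}

/-- The factor contributed by a single jump `p` to the joint characteristic function, at the
frequencies `-ξ`, of the increments of a walk between the times `σ`. -/
def jumpFactor (χ : AddChar K Circle) (σ : Fin (N + 1) → Icc (0 : ℝ) t) (ξ : Fin N → K)
    (p : Ioo (0 : ℝ) t × grid S β n) : ℂ :=
  ∏ j, if (p.1 : ℝ) ∈ Ioc (σ j.castSucc : ℝ) (σ j.succ) then (χ (-(p.2 * ξ j)) : ℂ) else 1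

lemma norm_jumpFactor_le_one (p : Ioo (0 : ℝ) t × grid S β n) : ‖jumpFactor χ σ ξ p‖ ≤ 1 := by
  rw [jumpFactor, norm_prod]
  refine Finset.prod_le_one (fun _ _ => norm_nonneg _) fun j _ => ?_
  split_ifs
  · exact (Circle.norm_coe _).le
  · exact norm_one.le

lemma prod_addChar_walk_increment (hσ : Monotone σ) (a : K) (w : JumpConfig S β n t) :
    ∏ j, (χ (-((walk a w (σ j.succ) - walk a w (σ j.castSucc)) * ξ j)) : ℂ) =
      ∏ i, jumpFactor χ σ ξ (w.2 i) := by
  simp only [jumpFactor]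
  rw [Finset.prod_comm]
  refine Finset.prod_congr rfl fun j _ => ?_
  rw [walk_sub_walk a w (hσ j.castSucc_lt_succ.le), Finset.sum_mul, ← Finset.sum_neg_distrib,
    coe_addChar_sum]
  refine Finset.prod_congr rfl fun i _ => ?_
  split_ifs
  · rfl
  · rw [zero_mul, neg_zero, AddChar.map_zero_eq_one, Circle.coe_one]

variable [MeasurableSpace K] [MeasurableSingletonClass K]

omit [MeasurableSingletonClass K] in
lemma measurableSet_jump_mem_Ioc (r s : ℝ) :
    MeasurableSet {p : Ioo (0 : ℝ) t × grid S β n | (p.1 : ℝ) ∈ Ioc r s} :=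
  measurable_subtype_coe.comp measurable_fst measurableSet_Ioc

lemma measurable_jumpFactor :
    Measurable (jumpFactor χ σ ξ : Ioo (0 : ℝ) t × grid S β n → ℂ) := by
  refine Finset.measurable_prod _ fun j _ =>
    Measurable.ite (measurableSet_jump_mem_Ioc _ _) ?_ measurable_const
  exact (measurable_of_countable fun y : grid S β n => (χ (-(y * ξ j)) : ℂ)).comp measurable_snd

variable [IsUltrametricDist K]

lemma IsRankZeroCharacter.integral_jump_mem_Ioc (hχ : IsRankZeroCharacter β χ)
    (hβ : IsUniformizer β) (hS : IsDigitSet S) (hα : 0 < α) {r s : ℝ} (hr : 0 ≤ r) (hrs : r ≤ s)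
    (hs : s ≤ t) {η : K} (hη : η ∈ grid S β n) :
    ∫ p : Ioo (0 : ℝ) t × grid S β n,
        (if (p.1 : ℝ) ∈ Ioc r s then (χ (-(p.2 * η)) : ℂ) - 1 else 0) ∂jumpIntensity S β χ α n t =
      (-(s - r) * ‖η‖ ^ α : ℝ) := by
  have hIoc : MeasurableSet (Subtype.val ⁻¹' Ioc r s : Set (Ioo (0 : ℝ) t)) :=
    measurable_subtype_coe measurableSet_Ioc
  have hjump : ∫ y : grid S β n, ((χ (-(y * η)) : ℂ) - 1) ∂jumpLaw S β χ α n =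
      ((-‖η‖ ^ α : ℝ) : ℂ) := by
    rw [integral_sub Integrable.of_finite (integrable_const 1),
      hχ.integral_jumpLaw hβ hS hα.le hη, integral_const, hχ.jumpLaw_real_univ hβ hS hα,
      Complex.real_smul]
    push_cast
    ring
  calc ∫ p : Ioo (0 : ℝ) t × grid S β n,
        (if (p.1 : ℝ) ∈ Ioc r s then (χ (-(p.2 * η)) : ℂ) - 1 else 0) ∂jumpIntensity S β χ α n t
    _ = ∫ p : Ioo (0 : ℝ) t × grid S β n,
          (Subtype.val ⁻¹' Ioc r s).indicator (fun _ => (1 : ℂ)) p.1 *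
            ((χ (-(p.2 * η)) : ℂ) - 1) ∂jumpIntensity S β χ α n t := by
        refine integral_congr_ae (ae_of_all _ fun p => ?_)
        beta_reduce
        by_cases hp : (p.1 : ℝ) ∈ Ioc r s
        · rw [if_pos hp, indicator_of_mem (mem_preimage.2 hp), one_mul]
        · rw [if_neg hp, indicator_of_notMem (mt mem_preimage.1 hp), zero_mul]
    _ = (s - r : ℝ) * (-‖η‖ ^ α : ℝ) := by
        rw [jumpIntensity, integral_prod_mul ((Subtype.val ⁻¹' Ioc r s).indicator fun _ => (1 : ℂ))
          (fun y : grid S β n => (χ (-(y * η)) : ℂ) - 1), hjump, integral_indicator_const _ hIoc,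
          jumpTimeMeasure_real_preimage_Ioc hr hrs hs, Complex.real_smul, mul_one]
    _ = _ := by
        push_cast
        ring

lemma IsRankZeroCharacter.integral_jumpFactor_sub_one (hχ : IsRankZeroCharacter β χ)
    (hβ : IsUniformizer β) (hS : IsDigitSet S) (hα : 0 < α) (hσ : Monotone σ)
    (hξ : ∀ j, ξ j ∈ grid S β n) :
    ∫ p : Ioo (0 : ℝ) t × grid S β n, (jumpFactor χ σ ξ p - 1) ∂jumpIntensity S β χ α n t =
      ∑ j, ((-((σ j.succ : ℝ) - σ j.castSucc) * ‖ξ j‖ ^ α : ℝ) : ℂ) := by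
  have hdisj := pairwise_disjoint_Ioc_castSucc_succ ((Subtype.mono_coe _).comp hσ)
  have hint (j : Fin N) : Integrable (fun p : Ioo (0 : ℝ) t × grid S β n =>
      if (p.1 : ℝ) ∈ Ioc (σ j.castSucc : ℝ) (σ j.succ) then (χ (-(p.2 * ξ j)) : ℂ) - 1 else 0)
      (jumpIntensity S β χ α n t) := by
    have hjump : Integrable (fun y : grid S β n => (χ (-(y * ξ j)) : ℂ) - 1)
      (jumpLaw S β χ α n) := Integrable.of_finite
    refine ((hjump.comp_snd (jumpTimeMeasure t)).indicator
      (measurableSet_jump_mem_Ioc (σ j.castSucc : ℝ) (σ j.succ))).congr (ae_of_all _ fun p => ?_)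
    classical exact indicator_apply _ _ _
  calc ∫ p : Ioo (0 : ℝ) t × grid S β n, (jumpFactor χ σ ξ p - 1) ∂jumpIntensity S β χ α n t
    _ = ∫ p : Ioo (0 : ℝ) t × grid S β n, ∑ j,
          (if (p.1 : ℝ) ∈ Ioc (σ j.castSucc : ℝ) (σ j.succ) then (χ (-(p.2 * ξ j)) : ℂ) - 1 else 0)
          ∂jumpIntensity S β χ α n t :=
        integral_congr_ae (ae_of_all _ fun p => prod_ite_one_sub_one hdisj _ _ _)
    _ = _ := by
        rw [integral_finsetSum _ fun j _ => hint j]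
        exact Finset.sum_congr rfl fun j _ => hχ.integral_jump_mem_Ioc hβ hS hα
          (σ j.castSucc).2.1 (hσ j.castSucc_lt_succ.le) (σ j.succ).2.2 (hξ j)

lemma IsRankZeroCharacter.integral_prod_addChar_walk_increment (hχ : IsRankZeroCharacter β χ)
    (hβ : IsUniformizer β) (hS : IsDigitSet S) (hα : 0 < α) (hσ : Monotone σ)
    (hξ : ∀ j, ξ j ∈ grid S β n) (a : K) :
    ∫ w, ∏ j, (χ (-((walk a w (σ j.succ) - walk a w (σ j.castSucc)) * ξ j)) : ℂ)
        ∂poissonLaw (jumpIntensity S β χ α n t) =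
      ∏ j, (Real.exp (-((σ j.succ : ℝ) - σ j.castSucc) * ‖ξ j‖ ^ α) : ℂ) := by
  rw [integral_congr_ae (ae_of_all _ fun w => prod_addChar_walk_increment hσ a w),
    integral_prod_poissonLaw measurable_jumpFactor norm_jumpFactor_le_one,
    hχ.integral_jumpFactor_sub_one hβ hS hα hσ hξ, Complex.exp_sum]
  simp only [Complex.ofReal_exp]

omit [MeasurableSpace K] [MeasurableSingletonClass K] in
lemma IsRankZeroCharacter.indicator_ball_neg (hχ : IsRankZeroCharacter β χ) (hβ : IsUniformizer β)
    (hS : IsDigitSet S) {z : K} (hz : z ∈ ball β n) :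
    (ball β (-n)).indicator (fun _ => (1 : ℂ)) z =
      ∑ η ∈ grid S β n, ((S.card : ℂ) ^ n * (S.card : ℂ) ^ n)⁻¹ * (χ (z * η) : ℂ) := by
  have hq : (S.card : ℂ) ^ n * (S.card : ℂ) ^ n ≠ 0 := by
    have := hS.card_pos.ne'
    norm_cast at this ⊢
    positivity
  rw [← Finset.mul_sum, hχ.sum_grid_apply_mul hβ hS hz, ← inv_mul_cancel₀ hq, indicator_const_mul]

omit [MeasurableSpace K] [MeasurableSingletonClass K] in
lemma IsRankZeroCharacter.ofReal_density_mul_inv (hχ : IsRankZeroCharacter β χ)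
    (hβ : IsUniformizer β) (hS : IsDigitSet S) (hα : 0 ≤ α) {s : ℝ} (hs : 0 ≤ s) {x : K}
    (hx : x ∈ ball β n) :
    ((density S β χ α n s x * ((S.card : ℝ) ^ n)⁻¹ : ℝ) : ℂ) =
      ∑ η ∈ grid S β n, ((S.card : ℂ) ^ n * (S.card : ℂ) ^ n)⁻¹ * (χ (x * η) : ℂ) *
        (Real.exp (-s * ‖η‖ ^ α) : ℂ) := by
  rw [Complex.ofReal_mul, hχ.ofReal_density hβ hS hα hs hx, finiteFourierInv, Finset.mul_sum,
    Finset.sum_mul]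
  refine Finset.sum_congr rfl fun η _ => ?_
  rw [mul_inv]
  push_cast
  ring

omit [MeasurableSpace K] [MeasurableSingletonClass K] in
lemma IsRankZeroCharacter.prod_indicator_ball_neg (hχ : IsRankZeroCharacter β χ)
    (hβ : IsUniformizer β) (hS : IsDigitSet S) {c d : Fin N → K} (hc : ∀ j, c j ∈ ball β n)
    (hd : ∀ j, d j ∈ ball β n) :
    ∏ j, (ball β (-n)).indicator (fun _ => (1 : ℂ)) (c j - d j) =
      ∑ ξ ∈ Fintype.piFinset fun _ : Fin N => grid S β n,
        (∏ j, ((S.card : ℂ) ^ n * (S.card : ℂ) ^ n)⁻¹ * (χ (c j * ξ j) : ℂ)) *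
          ∏ j, (χ (-(d j * ξ j)) : ℂ) := by
  rw [Finset.prod_congr rfl fun j _ =>
    hχ.indicator_ball_neg hβ hS (sub_mem_ball (hc j) (hd j)), Finset.prod_univ_sum]
  refine Finset.sum_congr rfl fun ξ _ => ?_
  rw [← Finset.prod_mul_distrib]
  refine Finset.prod_congr rfl fun j _ => ?_
  rw [mul_assoc, ← Circle.coe_mul, ← AddChar.map_add_eq_mul]
  ring_nf

lemma IsRankZeroCharacter.poissonLaw_real_forall_increment (hχ : IsRankZeroCharacter β χ)
    (hβ : IsUniformizer β) (hS : IsDigitSet S) (hα : 0 < α) (hσ : Monotone σ) {a : K}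
    (ha : a ∈ grid S β n) {c : Fin N → K} (hc : ∀ j, c j ∈ ball β n) :
    (poissonLaw (jumpIntensity S β χ α n t)).real
        {w | ∀ j, c j - (walk a w (σ j.succ) - walk a w (σ j.castSucc)) ∈ ball β (-n)} =
      ∏ j, density S β χ α n ((σ j.succ : ℝ) - σ j.castSucc) (c j) * ((S.card : ℝ) ^ n)⁻¹ := by
  set A : Set (JumpConfig S β n t) :=
    {w | ∀ j, c j - (walk a w (σ j.succ) - walk a w (σ j.castSucc)) ∈ ball β (-n)} with hA_def
  have hA : MeasurableSet A := by
    rw [← measurable_mem]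
    exact measurable_comp_walk hS (fun k => (σ k : ℝ))
      fun x => ∀ j : Fin N, c j - (x j.succ - x j.castSucc) ∈ ball β (-n)
  have hindicator (w : JumpConfig S β n t) : A.indicator (fun _ => (1 : ℂ)) w =
      ∑ ξ ∈ Fintype.piFinset fun _ : Fin N => grid S β n,
        (∏ j, ((S.card : ℂ) ^ n * (S.card : ℂ) ^ n)⁻¹ * (χ (c j * ξ j) : ℂ)) *
          ∏ j, (χ (-((walk a w (σ j.succ) - walk a w (σ j.castSucc)) * ξ j)) : ℂ) := by
    rw [← hχ.prod_indicator_ball_neg hβ hS hc fun j =>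
      sub_mem_ball (hβ.walk_mem_ball hS ha w _) (hβ.walk_mem_ball hS ha w _)]
    classical
    simp only [indicator_apply, Fintype.prod_ite_zero, Finset.prod_const_one, hA_def, mem_ofPred_eq]
  have hint (ξ : Fin N → K) : Integrable (fun w : JumpConfig S β n t =>
      ∏ j, (χ (-((walk a w (σ j.succ) - walk a w (σ j.castSucc)) * ξ j)) : ℂ))
      (poissonLaw (jumpIntensity S β χ α n t)) := by
    simp only [prod_addChar_walk_increment hσ]
    exact integrable_prod_poissonLaw measurable_jumpFactor norm_jumpFactor_le_one
  rw [← Complex.ofReal_inj, Complex.ofReal_prod, Finset.prod_congr rfl fun j _ =>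
    hχ.ofReal_density_mul_inv hβ hS hα.le
      (sub_nonneg.2 (Subtype.coe_le_coe.2 (hσ j.castSucc_lt_succ.le))) (hc j),
    Finset.prod_univ_sum]
  calc ((poissonLaw (jumpIntensity S β χ α n t)).real A : ℂ)
    _ = ∫ w, A.indicator (fun _ => (1 : ℂ)) w ∂poissonLaw (jumpIntensity S β χ α n t) := by
        rw [integral_indicator_const _ hA, Complex.real_smul, mul_one]
    _ = _ := by
        simp only [hindicator]
        rw [integral_finsetSum _ fun ξ _ => (hint ξ).const_mul _]
        refine Finset.sum_congr rfl fun ξ hξ => ?_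
        rw [integral_const_mul, hχ.integral_prod_addChar_walk_increment hβ hS hα hσ
          (Fintype.mem_piFinset.1 hξ), ← Finset.prod_mul_distrib]

end Increments

section Existence

variable {K : Type*} [NontriviallyNormedField K] [MeasurableSpace K] {β : K} {S : Finset K}
  {χ : AddChar K Circle} {α : ℝ} {n : ℕ} {t : ℝ} {a : K}

/-- The law on path space of the compound Poisson walk on the grid, started at `a`, whose jumps
occur at rate `jumpWeight`. It is the measure `𝐏ⁿ_a`. -/
def compoundPoisson (S : Finset K) (β : K) (χ : AddChar K Circle) (α : ℝ) (n : ℕ) (t : ℝ) (a : K) :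
    Measure (SkorokhodSpace K t) :=
  (poissonLaw (jumpIntensity S β χ α n t)).map (jumpPath a)

variable [MeasurableSingletonClass K]

lemma isProbabilityMeasure_compoundPoisson (hS : IsDigitSet S) :
    IsProbabilityMeasure (compoundPoisson S β χ α n t a) :=
  Measure.isProbabilityMeasure_map (measurable_jumpPath hS).aemeasurable

variable [IsUltrametricDist K]

lemma IsUniformizer.ae_compoundPoisson_mem_grid (hβ : IsUniformizer β) (hS : IsDigitSet S)
    (ha : a ∈ grid S β n) (s : Icc (0 : ℝ) t) :
    ∀ᵐ ω ∂compoundPoisson S β χ α n t a, ω.1 s ∈ grid S β n :=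
  (ae_map_iff (measurable_jumpPath hS).aemeasurable
    (measurable_eval_skorokhod s (Finset.measurableSet _))).2 <|
      ae_of_all _ fun w => hβ.gridRep_mem hS (hβ.walk_mem_ball hS ha w s)

lemma IsRankZeroCharacter.compoundPoisson_real_forall_succ_eq (hχ : IsRankZeroCharacter β χ)
    (hβ : IsUniformizer β) (hS : IsDigitSet S) (hα : 0 < α) {N : ℕ}
    {σ : Fin (N + 1) → Icc (0 : ℝ) t} (hσ : Monotone σ) (hσ_zero : (σ 0 : ℝ) = 0)
    {b : Fin (N + 1) → K} (hb : ∀ j, b j ∈ grid S β n) :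
    (compoundPoisson S β χ α n t (b 0)).real {ω | ∀ j : Fin N, ω.1 (σ j.succ) = b j.succ} =
      ∏ j : Fin N, density S β χ α n ((σ j.succ : ℝ) - σ j.castSucc) (b j.succ - b j.castSucc) *
        ((S.card : ℝ) ^ n)⁻¹ := by
  have hmeas : MeasurableSet {ω : SkorokhodSpace K t | ∀ j : Fin N, ω.1 (σ j.succ) = b j.succ} :=
    measurableSet_forall_eval_mem (fun j : Fin N => σ j.succ) (J := fun j => {b j.succ})
      fun j => measurableSet_singleton _
  rw [compoundPoisson, map_measureReal_apply (measurable_jumpPath hS) hmeas,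
    ← hχ.poissonLaw_real_forall_increment hβ hS hα hσ (hb 0)
      fun j => hβ.sub_mem_ball_of_mem_grid hS (hb j.succ) (hb j.castSucc)]
  exact congrArg _ (Set.ext fun w => hβ.jumpPath_eq_iff hS w hσ_zero hb)

lemma IsRankZeroCharacter.compoundPoisson_real_forall_eq (hχ : IsRankZeroCharacter β χ)
    (hβ : IsUniformizer β) (hS : IsDigitSet S) (hα : 0 < α) (ht : 0 ≤ t) (ha : a ∈ grid S β n)
    {N : ℕ} {τ : Fin N → Icc (0 : ℝ) t} (hτ : StrictMono τ) {b : Fin N → K}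
    (hb : ∀ j, b j ∈ grid S β n) :
    (compoundPoisson S β χ α n t a).real {ω | ∀ j, ω.1 (τ j) = b j} =
      ∏ j : Fin N, density S β χ α n
        ((τ j : ℝ) - (Fin.cons 0 (fun j => (τ j : ℝ)) : Fin (N + 1) → ℝ) j.castSucc)
        (b j - (Fin.cons a b : Fin (N + 1) → K) j.castSucc) * ((S.card : ℝ) ^ n)⁻¹ := by
  let σ : Fin (N + 1) → Icc (0 : ℝ) t := Fin.cons ⟨0, le_rfl, ht⟩ τ
  have hσ : Monotone σ := by
    intro i j hij
    cases i using Fin.cases with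
    | zero => exact (σ j).2.1
    | succ i =>
      cases j using Fin.cases with
      | zero => exact absurd hij (not_le.2 i.succ_pos)
      | succ j => exact hτ.monotone (Fin.succ_le_succ_iff.1 hij)
  have hσ_coe (k : Fin (N + 1)) :
      (Fin.cons 0 (fun j => (τ j : ℝ)) : Fin (N + 1) → ℝ) k = σ k := by
    cases k using Fin.cases <;> rfl
  have hb' (k : Fin (N + 1)) : (Fin.cons a b : Fin (N + 1) → K) k ∈ grid S β n :=
    Fin.cases ha hb k
  have h := hχ.compoundPoisson_real_forall_succ_eq hβ hS hα (σ := σ) hσ rfl (b := Fin.cons a b) hb'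
  simp only [hσ_coe]
  exact h

open Classical in
lemma ae_eq_biUnion_piFinset {Ω ι X : Type*} [MeasurableSpace Ω] [Fintype ι] [DecidableEq ι]
    {P : Measure Ω} {Z : ι → Ω → X} {G : Finset X} (hG : ∀ i, ∀ᵐ ω ∂P, Z i ω ∈ G) (J : ι → Set X) :
    {ω | ∀ i, Z i ω ∈ J i} =ᵐ[P]
      ⋃ b ∈ Fintype.piFinset fun i => G.filter (· ∈ J i), {ω | ∀ i, Z i ω = b i} := by
  filter_upwards [ae_all_iff.2 hG] with ω hω
  refine propext (?_ : (∀ i, Z i ω ∈ J i) ↔ ω ∈ ⋃ b ∈ _, _)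
  simp only [mem_iUnion, mem_ofPred_eq, exists_prop, Fintype.mem_piFinset, Finset.mem_filter]
  exact ⟨fun h => ⟨fun i => Z i ω, fun i => ⟨hω i, h i⟩, fun i => rfl⟩,
    fun ⟨b, hb, h⟩ i => h i ▸ (hb i).2⟩

open Classical in
lemma measureReal_forall_mem_eq_sum {Ω ι X : Type*} [MeasurableSpace Ω] [Fintype ι] [DecidableEq ι]
    [MeasurableSpace X] [MeasurableSingletonClass X] {P : Measure Ω} [IsFiniteMeasure P]
    {Z : ι → Ω → X} (hZ : ∀ i, Measurable (Z i)) {G : Finset X} (hG : ∀ i, ∀ᵐ ω ∂P, Z i ω ∈ G)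
    (J : ι → Set X) :
    P.real {ω | ∀ i, Z i ω ∈ J i} =
      ∑ b ∈ Fintype.piFinset fun i => G.filter (· ∈ J i), P.real {ω | ∀ i, Z i ω = b i} := by
  rw [measureReal_congr (ae_eq_biUnion_piFinset hG J), measureReal_biUnion_finset]
  · exact fun b _ c _ hbc => Set.disjoint_left.2 fun ω hb hc =>
      hbc (funext fun i => (hb i).symm.trans (hc i))
  · intro b _
    rw [ofPred_forall]
    exact MeasurableSet.iInter fun i => hZ i (measurableSet_singleton (b i))

theorem IsRankZeroCharacter.isPathMeasure_compoundPoisson (hχ : IsRankZeroCharacter β χ)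
    (hβ : IsUniformizer β) (hS : IsDigitSet S) (hα : 0 < α) (ht : 0 ≤ t) (ha : a ∈ grid S β n) :
    IsPathMeasure S β χ α n t a (compoundPoisson S β χ α n t a) := by
  classical
  have := isProbabilityMeasure_compoundPoisson (β := β) (χ := χ) (α := α) (n := n) (t := t)
    (a := a) hS
  refine ⟨this, fun N τ J hτ _ => ?_⟩
  rw [measureReal_forall_mem_eq_sum (fun i => measurable_eval_skorokhod (τ i))
    fun i => hβ.ae_compoundPoisson_mem_grid hS ha (τ i)]
  refine Finset.sum_congr rfl fun b hb => ?_
  exact hχ.compoundPoisson_real_forall_eq hβ hS hα ht ha hτ fun j =>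
    (Finset.mem_filter.1 (Fintype.mem_piFinset.1 hb j)).1

theorem IsRankZeroCharacter.existsUnique_isPathMeasure (hχ : IsRankZeroCharacter β χ)
    (hβ : IsUniformizer β) (hS : IsDigitSet S) (hα : 0 < α) (ht : 0 ≤ t) (ha : a ∈ grid S β n) :
    ∃! P : Measure (SkorokhodSpace K t), IsPathMeasure S β χ α n t a P :=
  ⟨_, hχ.isPathMeasure_compoundPoisson hβ hS hα ht ha, fun _ hP =>
    hP.unique (hχ.isPathMeasure_compoundPoisson hβ hS hα ht ha)⟩

lemma IsRankZeroCharacter.isPathMeasure_pathMeasure (hχ : IsRankZeroCharacter β χ)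
    (hβ : IsUniformizer β) (hS : IsDigitSet S) (hα : 0 < α) (ht : 0 ≤ t) (ha : a ∈ grid S β n) :
    IsPathMeasure S β χ α n t a (pathMeasure S β χ α n t a) :=
  Classical.epsilon_spec (hχ.existsUnique_isPathMeasure hβ hS hα ht ha).exists

end Existence

section PathIntegrals

lemma bddAbove_range_of_forall_eventually_le {X : Type*} [TopologicalSpace X] [CompactSpace X]
    {f : X → ℝ} (hf : ∀ x, ∃ M, ∀ᶠ y in 𝓝 x, f y ≤ M) : BddAbove (range f) := by
  rw [← image_univ]
  refine isCompact_univ.induction_on (by simp) (fun _ _ hAB hB => hB.mono (image_mono hAB))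
    (fun _ _ hA hB => image_union f _ _ ▸ hA.union hB) fun x _ => ?_
  obtain ⟨M, hM⟩ := hf x
  exact ⟨_, mem_nhdsWithin_of_mem_nhds hM, M, forall_mem_image.2 fun _ hy => hy⟩

variable {K : Type*} [NontriviallyNormedField K] {t : ℝ} {v : K → ℝ}

lemma IsSkorokhod.continuousWithinAt_Ici {ω : Icc (0 : ℝ) t → K} (hω : IsSkorokhod ω)
    (s : Icc (0 : ℝ) t) : ContinuousWithinAt ω (Ici s) s :=
  continuousWithinAt_Ioi_iff_Ici.1 (hω.right_cont s)

lemma IsSkorokhod.bddAbove_range_comp {ω : Icc (0 : ℝ) t → K} (hω : IsSkorokhod ω)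
    (hv : Continuous v) : BddAbove (range (v ∘ ω)) := by
  refine bddAbove_range_of_forall_eventually_le fun s => ?_
  obtain ⟨l, hl⟩ := hω.left_lim s
  have hleft : ∀ᶠ u in 𝓝[<] s, v (ω u) < v l + 1 :=
    ((hv.tendsto l).comp hl).eventually_lt_const (lt_add_one _)
  have hright : ∀ᶠ u in 𝓝[≥] s, v (ω u) < v (ω s) + 1 :=
    ((hv.tendsto _).comp (hω.continuousWithinAt_Ici s)).eventually_lt_const (lt_add_one _)
  refine ⟨max (v l + 1) (v (ω s) + 1), ?_⟩
  rw [← nhdsLT_sup_nhdsGE, eventually_sup]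
  exact ⟨hleft.mono fun u hu => hu.le.trans (le_max_left _ _),
    hright.mono fun u hu => hu.le.trans (le_max_right _ _)⟩

lemma tendsto_projIcc_ceil (ht : 0 ≤ t) (s : Icc (0 : ℝ) t) :
    Tendsto (fun N : ℕ => projIcc 0 t ht (⌈(s : ℝ) * N⌉₊ / N)) atTop (𝓝[≥] s) := by
  have hlim : Tendsto (fun N : ℕ => (⌈(s : ℝ) * N⌉₊ / N : ℝ)) atTop (𝓝 s) :=
    (tendsto_nat_ceil_mul_div_atTop s.2.1).comp tendsto_natCast_atTop_atTop
  have hproj := (continuous_projIcc (h := ht)).tendsto (s : ℝ) |>.comp hlim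
  rw [projIcc_val ht s] at hproj
  refine tendsto_nhdsWithin_iff.2 ⟨hproj, ?_⟩
  filter_upwards [eventually_gt_atTop 0] with N hN
  have hle : (s : ℝ) ≤ ⌈(s : ℝ) * N⌉₊ / N := (le_div_iff₀ (by positivity)).2 (Nat.le_ceil _)
  simpa only [projIcc_val, mem_Ici] using monotone_projIcc ht hle

variable [MeasurableSpace K] [BorelSpace K]

theorem measurable_uncurry_skorokhod (ht : 0 ≤ t) :
    Measurable fun p : SkorokhodSpace K t × Icc (0 : ℝ) t => p.1.1 p.2 := by
  refine measurable_of_tendsto_metrizable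
    (f := fun (N : ℕ) (p : SkorokhodSpace K t × Icc (0 : ℝ) t) =>
      p.1.1 (projIcc 0 t ht (⌈(p.2 : ℝ) * N⌉₊ / N))) (fun N => ?_) (tendsto_pi_nhds.2 fun p => ?_)
  · have hgrid : Measurable fun q : SkorokhodSpace K t × ℕ => q.1.1 (projIcc 0 t ht (q.2 / N)) :=
      measurable_from_prod_countable_left fun k =>
        measurable_eval_skorokhod (projIcc 0 t ht (k / N))
    have hceil : Measurable fun p : SkorokhodSpace K t × Icc (0 : ℝ) t =>
        (p.1, ⌈(p.2 : ℝ) * N⌉₊) := by fun_prop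
    exact hgrid.comp hceil
  · exact (p.1.2.continuousWithinAt_Ici p.2).tendsto.comp (tendsto_projIcc_ceil ht p.2)

lemma measurable_comp_projIcc (hv : Continuous v) (ht : 0 ≤ t) :
    Measurable fun p : SkorokhodSpace K t × ℝ => v (p.1.1 (projIcc 0 t ht p.2)) :=
  hv.measurable.comp <| (measurable_uncurry_skorokhod ht).comp <|
    measurable_fst.prodMk ((continuous_projIcc (h := ht)).measurable.comp measurable_snd)

lemma measurable_exp_neg_integral (hv : Continuous v) (ht : 0 ≤ t) :
    Measurable fun ω : SkorokhodSpace K t =>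
      Real.exp (-∫ s in (0 : ℝ)..t, v (ω.1 (projIcc 0 t ht s))) := by
  simp_rw [intervalIntegral.integral_of_le ht]
  exact ((measurable_comp_projIcc hv ht).stronglyMeasurable.integral_prod_right
    (ν := volume.restrict (Ioc 0 t))).measurable.neg.exp

omit [BorelSpace K] [MeasurableSpace K] in
lemma exp_neg_integral_mem_Icc (hv_nonneg : ∀ x, 0 ≤ v x) (ht : 0 ≤ t) (ω : SkorokhodSpace K t) :
    Real.exp (-∫ s in (0 : ℝ)..t, v (ω.1 (projIcc 0 t ht s))) ∈ Icc 0 1 :=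
  ⟨(Real.exp_pos _).le, Real.exp_le_one_iff.2 <| neg_nonpos.2 <|
    intervalIntegral.integral_nonneg ht fun _ _ => hv_nonneg _⟩

lemma integrable_exp_neg_integral {P : Measure (SkorokhodSpace K t)} [IsFiniteMeasure P]
    (hv : Continuous v) (hv_nonneg : ∀ x, 0 ≤ v x) (ht : 0 ≤ t) :
    Integrable (fun ω : SkorokhodSpace K t =>
      Real.exp (-∫ s in (0 : ℝ)..t, v (ω.1 (projIcc 0 t ht s)))) P :=
  Integrable.of_mem_Icc 0 1 (measurable_exp_neg_integral hv ht).aemeasurable <|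
    ae_of_all _ (exp_neg_integral_mem_Icc hv_nonneg ht)

/-- Jensen's inequality for the uniform distribution on `(0, t)`. -/
lemma exp_neg_integral_le (hv : Continuous v) (hv_nonneg : ∀ x, 0 ≤ v x) (ht : 0 < t)
    (ω : SkorokhodSpace K t) :
    Real.exp (-∫ s in (0 : ℝ)..t, v (ω.1 (projIcc 0 t ht.le s))) ≤
      t⁻¹ * ∫ s in Ioo 0 t, Real.exp (-t * v (ω.1 (projIcc 0 t ht.le s))) := by
  have hmeas : Measurable fun s : ℝ => -t * v (ω.1 (projIcc 0 t ht.le s)) :=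
    ((measurable_comp_projIcc hv ht.le).comp measurable_prodMk_left).const_mul _
  obtain ⟨M, hM⟩ := ω.2.bddAbove_range_comp hv
  have hmem (s : ℝ) : -t * v (ω.1 (projIcc 0 t ht.le s)) ∈ Icc (-t * M) 0 :=
    ⟨mul_le_mul_of_nonpos_left (hM (mem_range_self _)) (neg_nonpos.2 ht.le),
      mul_nonpos_of_nonpos_of_nonneg (neg_nonpos.2 ht.le) (hv_nonneg _)⟩
  have hjensen := convexOn_exp.map_set_average_le (μ := volume) (t := Ioo 0 t)
    Real.continuous_exp.continuousOn isClosed_univ (by simp [ht]) (by simp) (by simp)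
    (Integrable.of_mem_Icc _ _ hmeas.aemeasurable (ae_of_all _ hmem))
    (Integrable.of_mem_Icc 0 1 hmeas.exp.aemeasurable <| ae_of_all _ fun s =>
      ⟨(Real.exp_pos _).le, Real.exp_le_one_iff.2 (hmem s).2⟩)
  rw [setAverage_eq, setAverage_eq, Real.volume_real_Ioo_of_le ht.le, sub_zero, smul_eq_mul,
    smul_eq_mul, integral_const_mul, ← mul_assoc, mul_neg, inv_mul_cancel₀ ht.ne', neg_one_mul]
    at hjensen
  rwa [intervalIntegral.integral_of_le ht.le, integral_Ioc_eq_integral_Ioo]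

theorem integral_exp_neg_integral_le {P : Measure (SkorokhodSpace K t)} [IsFiniteMeasure P]
    (hv : Continuous v) (hv_nonneg : ∀ x, 0 ≤ v x) (ht : 0 < t) {D : ℝ}
    (hD : ∀ s : Icc (0 : ℝ) t, (s : ℝ) < t → ∫ ω, Real.exp (-t * v (ω.1 s)) ∂P ≤ D) :
    ∫ ω, Real.exp (-∫ s in (0 : ℝ)..t, v (ω.1 (projIcc 0 t ht.le s))) ∂P ≤ D := by
  have hint : Integrable (fun p : SkorokhodSpace K t × ℝ =>
      Real.exp (-t * v (p.1.1 (projIcc 0 t ht.le p.2)))) (P.prod (volume.restrict (Ioo 0 t))) :=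
    Integrable.of_mem_Icc 0 1 ((measurable_comp_projIcc hv ht.le).const_mul _).exp.aemeasurable <|
      ae_of_all _ fun p => ⟨(Real.exp_pos _).le, Real.exp_le_one_iff.2 <|
        mul_nonpos_of_nonpos_of_nonneg (neg_nonpos.2 ht.le) (hv_nonneg _)⟩
  have hproj (s : ℝ) (hs : s ∈ Ioo 0 t) : (projIcc 0 t ht.le s : ℝ) < t := by
    rw [projIcc_of_mem ht.le (Ioo_subset_Icc_self hs)]
    exact hs.2
  calc ∫ ω, Real.exp (-∫ s in (0 : ℝ)..t, v (ω.1 (projIcc 0 t ht.le s))) ∂P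
    _ ≤ ∫ ω, (t⁻¹ * ∫ s in Ioo 0 t, Real.exp (-t * v (ω.1 (projIcc 0 t ht.le s)))) ∂P :=
      integral_mono (integrable_exp_neg_integral hv hv_nonneg ht.le)
        (hint.integral_prod_left.const_mul _) (exp_neg_integral_le hv hv_nonneg ht)
    _ = t⁻¹ * ∫ s in Ioo 0 t, ∫ ω, Real.exp (-t * v (ω.1 (projIcc 0 t ht.le s))) ∂P := by
      rw [integral_const_mul, integral_integral_swap hint]
    _ ≤ t⁻¹ * ∫ _ in Ioo 0 t, D := by
      refine mul_le_mul_of_nonneg_left ?_ (inv_pos.2 ht).le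
      exact setIntegral_mono_on hint.integral_prod_right (integrable_const _) measurableSet_Ioo
        fun s hs => hD _ (hproj s hs)
    _ = D := by
      rw [setIntegral_const, Real.volume_real_Ioo_of_le ht.le, sub_zero, smul_eq_mul,
        inv_mul_cancel_left₀ ht.ne']

end PathIntegrals

section Estimate

variable {K : Type*} [NontriviallyNormedField K] {β : K} {S : Finset K} {χ : AddChar K Circle}
  {α s t w C : ℝ} {n : ℕ} {r : ℤ} {v : K → ℝ} {a x y : K}

lemma sphereInf_le (hv_nonneg : ∀ x, 0 ≤ v x) (hyx : ‖y‖ = ‖x‖) : sphereInf v x ≤ v y :=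
  csInf_le ⟨0, forall_mem_image.2 fun z _ => hv_nonneg z⟩ (mem_image_of_mem v hyx)

lemma sphereInf_nonneg (hv_nonneg : ∀ x, 0 ≤ v x) (x : K) : 0 ≤ sphereInf v x :=
  Real.sInf_nonneg (forall_mem_image.2 fun z _ => hv_nonneg z)

/-- The event `ω(t) = x`; conditioning `𝐏ⁿ_x` on it gives the measure on loops at `x`. -/
def endEvent (ht : 0 < t) (x : K) : Set (SkorokhodSpace K t) := {ω | ω.1 ⟨t, ht.le, le_rfl⟩ = x}

variable [MeasurableSpace K]

open Classical in
lemma IsPathMeasure.real_eval_mem_eval_eq [MeasurableSingletonClass K]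
    {P : Measure (SkorokhodSpace K t)} (hP : IsPathMeasure S β χ α n t a P)
    {s s' : Icc (0 : ℝ) t} (hs : s < s') {J : Set K} (hJ : MeasurableSet J)
    (hx : x ∈ grid S β n) :
    P.real {ω | ω.1 s ∈ J ∧ ω.1 s' = x} = ∑ y ∈ grid S β n with y ∈ J,
      density S β χ α n s (y - a) * ((S.card : ℝ) ^ n)⁻¹ *
        (density S β χ α n (s' - s) (x - y) * ((S.card : ℝ) ^ n)⁻¹) := by
  have hmono : StrictMono ![s, s'] := by simpa [Fin.strictMono_iff_lt_succ] using hs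
  have hmeas : ∀ i, MeasurableSet ((![J, {x}] : Fin 2 → Set K) i) :=
    Fin.forall_fin_two.2 ⟨hJ, measurableSet_singleton x⟩
  have hevent : {ω : SkorokhodSpace K t | ω.1 s ∈ J ∧ ω.1 s' = x} =
      {ω | ∀ i, ω.1 (![s, s'] i) ∈ (![J, {x}] : Fin 2 → Set K) i} := by
    simp [Fin.forall_fin_two]
  rw [hevent, hP.2 2 _ _ hmono hmeas]
  refine Finset.sum_nbij' (fun b => b 0) (fun y => ![y, x]) ?_ ?_ ?_ ?_ ?_
  all_goals simp only [Fintype.mem_piFinset, Fin.forall_fin_two, Finset.mem_filter]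
  · exact fun b hb => hb.1
  · exact fun y hy => ⟨hy, hx, mem_singleton x⟩
  · rintro b ⟨-, -, rfl⟩
    exact List.ofFn_inj.1 rfl
  · exact fun y _ => rfl
  · rintro b ⟨-, -, rfl⟩
    rw [Fin.prod_univ_two]
    simp

variable [BorelSpace K]

open Classical in
lemma IsPathMeasure.real_eval_eq {P : Measure (SkorokhodSpace K t)}
    (hP : IsPathMeasure S β χ α n t a P) (s : Icc (0 : ℝ) t) (hx : x ∈ grid S β n) :
    P.real {ω | ω.1 s = x} = density S β χ α n s (x - a) * ((S.card : ℝ) ^ n)⁻¹ := by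
  have hfdd := hP.2 1 (fun _ => s) (fun _ => {x}) (Subsingleton.strictMono _)
    fun _ => measurableSet_singleton x
  rw [Finset.sum_eq_single fun _ => x] at hfdd
  · simpa using hfdd
  · exact fun b hb hne =>
      absurd (funext fun i => (Finset.mem_filter.1 (Fintype.mem_piFinset.1 hb i)).2) hne
  · exact fun h => absurd (Fintype.mem_piFinset.2 fun _ =>
      Finset.mem_filter.2 ⟨hx, mem_singleton x⟩) h

lemma IsUniformizer.measurableSet_sub_notMem_ball (hβ : IsUniformizer β) (r : ℤ) (x : K) :
    MeasurableSet {y | y - x ∉ ball β r} := by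
  simp only [hβ.mem_ball_iff, not_le]
  exact measurableSet_lt measurable_const (by fun_prop)

variable [IsUltrametricDist K]

lemma IsRankZeroCharacter.pathMeasure_real_endEvent (hχ : IsRankZeroCharacter β χ)
    (hβ : IsUniformizer β) (hS : IsDigitSet S) (hα : 0 < α) (ht : 0 < t) (hx : x ∈ grid S β n) :
    (pathMeasure S β χ α n t x).real (endEvent ht x) =
      ((S.card : ℝ) ^ n)⁻¹ * density S β χ α n t 0 := by
  rw [endEvent, (hχ.isPathMeasure_pathMeasure hβ hS hα ht.le hx).real_eval_eq _ hx, sub_self,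
    mul_comm]

lemma IsRankZeroCharacter.propagator_self_eq (hχ : IsRankZeroCharacter β χ)
    (hβ : IsUniformizer β) (hS : IsDigitSet S) (hα : 0 < α) (ht : 0 < t) (v : K → ℝ)
    (hx : x ∈ grid S β n) :
    propagator S β χ α v n ht x x = (S.card : ℝ) ^ n * ∫ ω in endEvent ht x,
      Real.exp (-∫ s in (0 : ℝ)..t, v (ω.1 (projIcc 0 t ht.le s)))
        ∂pathMeasure S β χ α n t x := by
  have hend := hχ.pathMeasure_real_endEvent hβ hS hα ht hx
  have hdensity : density S β χ α n t 0 ≠ 0 := (density_zero_pos hS).ne'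
  rw [endEvent] at hend ⊢
  rw [propagator, bridgeMeasure, ProbabilityTheory.cond, integral_smul_measure, ENNReal.toReal_inv,
    ← measureReal_def, hend, sub_self, smul_eq_mul]
  field_simp

omit [MeasurableSpace K] [BorelSpace K] in
open Classical in
lemma IsRankZeroCharacter.sum_density_mul_density_tail_le_of_density_zero_le
    (hχ : IsRankZeroCharacter β χ) (hβ : IsUniformizer β) (hS : IsDigitSet S) (hα : 0 < α)
    (hs : 0 ≤ s) (hst : s ≤ t) (hC : density S β χ α n w 0 ≤ C) (hr : -(n : ℤ) ≤ r)
    (hrn : r ≤ n) (hx : x ∈ grid S β n) :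
    ∑ y ∈ grid S β n with y - x ∉ ball β r,
      density S β χ α n s (y - x) * density S β χ α n w (y - x) ≤
        (S.card : ℝ) ^ n * (C * (t * (‖β‖ ^ r) ^ α)) := by
  have hC_nonneg : 0 ≤ C := (density_zero_pos hS).le.trans hC
  calc ∑ y ∈ grid S β n with y - x ∉ ball β r,
        density S β χ α n s (y - x) * density S β χ α n w (y - x)
    _ ≤ ∑ y ∈ grid S β n with y - x ∉ ball β r, density S β χ α n s (y - x) * C :=
      Finset.sum_le_sum fun y hy => mul_le_mul_of_nonneg_left
        ((density_le_density_zero _).trans hC) (hχ.density_nonneg hβ hS hα.le hs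
          (hβ.sub_mem_ball_of_mem_grid hS (Finset.mem_filter.1 hy).1 hx))
    _ ≤ (S.card : ℝ) ^ n * (s * (‖β‖ ^ r) ^ α) * C := by
      rw [← Finset.sum_mul]
      gcongr
      exact hχ.sum_density_tail_le hβ hS hα hs hr hrn (hβ.mem_ball_of_mem_grid hS hx)
    _ ≤ (S.card : ℝ) ^ n * (t * (‖β‖ ^ r) ^ α) * C := by gcongr
    _ = (S.card : ℝ) ^ n * (C * (t * (‖β‖ ^ r) ^ α)) := by ring

omit [MeasurableSpace K] [BorelSpace K] in
open Classical in
/-- One of `s` and `t - s` is at least `t / 2`, so one of the two densities is bounded. -/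
lemma IsRankZeroCharacter.sum_density_mul_density_tail_le (hχ : IsRankZeroCharacter β χ)
    (hβ : IsUniformizer β) (hS : IsDigitSet S) (hα : 0 < α) (hs : s ∈ Icc 0 t)
    (hC : density S β χ α n (t / 2) 0 ≤ C) (hr : -(n : ℤ) ≤ r) (hrn : r ≤ n)
    (hx : x ∈ grid S β n) :
    ∑ y ∈ grid S β n with y - x ∉ ball β r,
      density S β χ α n s (y - x) * density S β χ α n (t - s) (y - x) ≤
        (S.card : ℝ) ^ n * (C * (t * (‖β‖ ^ r) ^ α)) := by
  rcases le_total s (t / 2) with h | h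
  · exact hχ.sum_density_mul_density_tail_le_of_density_zero_le hβ hS hα hs.1 hs.2
      ((density_zero_antitone (by linarith)).trans hC) hr hrn hx
  · simp_rw [mul_comm (density S β χ α n s _)]
    exact hχ.sum_density_mul_density_tail_le_of_density_zero_le hβ hS hα (sub_nonneg.2 hs.2)
      (sub_le_self t hs.1) ((density_zero_antitone h).trans hC) hr hrn hx

lemma IsRankZeroCharacter.pathMeasure_real_far_inter_endEvent_le (hχ : IsRankZeroCharacter β χ)
    (hβ : IsUniformizer β) (hS : IsDigitSet S) (hα : 0 < α) (ht : 0 < t)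
    (hC : density S β χ α n (t / 2) 0 ≤ C) (hr : -(n : ℤ) ≤ r) (hrn : r ≤ n)
    (hx : x ∈ grid S β n) {s : Icc (0 : ℝ) t} (hs : (s : ℝ) < t) :
    (S.card : ℝ) ^ n * (pathMeasure S β χ α n t x).real
      ({ω | ω.1 s - x ∉ ball β r} ∩ endEvent ht x) ≤ C * (t * (‖β‖ ^ r) ^ α) := by
  classical
  have hq : (0 : ℝ) < (S.card : ℝ) ^ n := pow_pos hS.card_pos n
  have hfdd := (hχ.isPathMeasure_pathMeasure hβ hS hα ht.le hx).real_eval_mem_eval_eq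
    (s := s) (s' := ⟨t, ht.le, le_rfl⟩) hs (hβ.measurableSet_sub_notMem_ball r x) hx
  have hsum := hχ.sum_density_mul_density_tail_le hβ hS hα s.2 hC hr hrn hx
  rw [← inv_mul_le_iff₀ hq, Finset.mul_sum] at hsum
  refine le_trans (le_of_eq ?_) hsum
  refine (congrArg _ hfdd).trans ?_
  rw [Finset.mul_sum]
  refine Finset.sum_congr (by ext y; simp) fun y _ => ?_
  rw [← neg_sub y x, density_neg]
  field_simp

omit [MeasurableSpace K] [BorelSpace K] in
/-- By the ultrametric inequality, `y` lies on the sphere `|y| = |x|` unless it is far from `x`. -/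
lemma IsUniformizer.exp_neg_mul_le_add_indicator (hβ : IsUniformizer β)
    (hv_nonneg : ∀ x, 0 ≤ v x) (ht : 0 ≤ t) (hrx : ‖β‖ ^ (-r) < ‖x‖) (y : K) :
    Real.exp (-t * v y) ≤
      Real.exp (-t * sphereInf v x) + {y | y - x ∉ ball β r}.indicator 1 y := by
  by_cases hy : y - x ∈ ball β r
  · have hnorm : ‖y‖ = ‖x‖ := by
      rw [← norm_neg x]
      refine IsUltrametricDist.norm_eq_of_add_norm_lt_max (lt_max_of_lt_right ?_)
      rw [← sub_eq_add_neg, norm_neg]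
      exact (hβ.mem_ball_iff.1 hy).trans_lt hrx
    rw [indicator_of_notMem (not_not.2 hy), add_zero]
    exact Real.exp_le_exp.2
      (mul_le_mul_of_nonpos_left (sphereInf_le hv_nonneg hnorm) (neg_nonpos.2 ht))
  · rw [indicator_of_mem (by exact hy), Pi.one_apply]
    refine le_add_of_nonneg_of_le (Real.exp_pos _).le (Real.exp_le_one_iff.2 ?_)
    exact mul_nonpos_of_nonpos_of_nonneg (neg_nonpos.2 ht) (hv_nonneg y)

lemma IsRankZeroCharacter.setIntegral_exp_neg_mul_eval_le (hχ : IsRankZeroCharacter β χ)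
    (hβ : IsUniformizer β) (hS : IsDigitSet S) (hα : 0 < α) (ht : 0 < t) (hv : Continuous v)
    (hv_nonneg : ∀ x, 0 ≤ v x) (hC : density S β χ α n (t / 2) 0 ≤ C) (hr : -(n : ℤ) ≤ r)
    (hrn : r ≤ n) (hx : x ∈ grid S β n) (hrx : ‖β‖ ^ (-r) < ‖x‖) {s : Icc (0 : ℝ) t}
    (hs : (s : ℝ) < t) :
    ∫ ω in endEvent ht x, Real.exp (-t * v (ω.1 s)) ∂pathMeasure S β χ α n t x ≤
      ((S.card : ℝ) ^ n)⁻¹ *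
        (C * (Real.exp (-t * sphereInf v x) + t * (‖β‖ ^ r) ^ α)) := by
  have hprob := (hχ.isPathMeasure_pathMeasure hβ hS hα ht.le hx).1
  set P := pathMeasure S β χ α n t x
  set far : Set (SkorokhodSpace K t) := {ω | ω.1 s - x ∉ ball β r}
  have hfar : MeasurableSet far :=
    measurable_eval_skorokhod s (hβ.measurableSet_sub_notMem_ball r x)
  have hmeas : Measurable fun ω : SkorokhodSpace K t => Real.exp (-t * v (ω.1 s)) :=
    ((hv.measurable.comp (measurable_eval_skorokhod s)).const_mul _).exp
  have hint : Integrable (fun ω => Real.exp (-t * v (ω.1 s))) (P.restrict (endEvent ht x)) :=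
    Integrable.of_mem_Icc 0 1 hmeas.aemeasurable <| ae_of_all _ fun ω =>
      ⟨(Real.exp_pos _).le, Real.exp_le_one_iff.2 <|
        mul_nonpos_of_nonpos_of_nonneg (neg_nonpos.2 ht.le) (hv_nonneg _)⟩
  have hint_far : Integrable (far.indicator 1) (P.restrict (endEvent ht x)) :=
    (integrable_const (1 : ℝ)).indicator hfar
  have hq : (0 : ℝ) < (S.card : ℝ) ^ n := pow_pos hS.card_pos n
  calc ∫ ω in endEvent ht x, Real.exp (-t * v (ω.1 s)) ∂P
    _ ≤ ∫ ω in endEvent ht x, (Real.exp (-t * sphereInf v x) + far.indicator 1 ω) ∂P :=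
      integral_mono hint ((integrable_const _).add hint_far) fun ω =>
        hβ.exp_neg_mul_le_add_indicator hv_nonneg ht.le hrx (ω.1 s)
    _ = P.real (endEvent ht x) * Real.exp (-t * sphereInf v x) +
        P.real (far ∩ endEvent ht x) := by
      rw [integral_add (integrable_const _) hint_far, setIntegral_const, smul_eq_mul,
        integral_indicator_one hfar, measureReal_restrict_apply hfar]
    _ ≤ ((S.card : ℝ) ^ n)⁻¹ * C * Real.exp (-t * sphereInf v x) +
        ((S.card : ℝ) ^ n)⁻¹ * (C * (t * (‖β‖ ^ r) ^ α)) := by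
      rw [hχ.pathMeasure_real_endEvent hβ hS hα ht hx]
      gcongr
      · exact (density_zero_antitone (half_le_self ht.le)).trans hC
      · rw [le_inv_mul_iff₀ hq]
        exact hχ.pathMeasure_real_far_inter_endEvent_le hβ hS hα ht hC hr hrn hx hs
    _ = _ := by ring

theorem IsRankZeroCharacter.propagator_self_le_density (hχ : IsRankZeroCharacter β χ)
    (hβ : IsUniformizer β) (hS : IsDigitSet S) (hα : 0 < α) (ht : 0 < t) (hv : Continuous v)
    (hv_nonneg : ∀ x, 0 ≤ v x) (hx : x ∈ grid S β n) :
    propagator S β χ α v n ht x x ≤ density S β χ α n t 0 := by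
  have hprob := (hχ.isPathMeasure_pathMeasure hβ hS hα ht.le hx).1
  rw [hχ.propagator_self_eq hβ hS hα ht v hx, ← le_inv_mul_iff₀ (pow_pos hS.card_pos n),
    ← hχ.pathMeasure_real_endEvent hβ hS hα ht hx]
  refine (integral_mono (integrable_exp_neg_integral hv hv_nonneg ht.le) (integrable_const 1)
    fun ω => (exp_neg_integral_mem_Icc hv_nonneg ht.le ω).2).trans_eq ?_
  rw [setIntegral_const, smul_eq_mul, mul_one]

lemma IsRankZeroCharacter.propagator_self_le_of_zpow_lt_norm (hχ : IsRankZeroCharacter β χ)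
    (hβ : IsUniformizer β) (hS : IsDigitSet S) (hα : 0 < α) (ht : 0 < t) (hv : Continuous v)
    (hv_nonneg : ∀ x, 0 ≤ v x) (hC : density S β χ α n (t / 2) 0 ≤ C) (hr : -(n : ℤ) ≤ r)
    (hrn : r ≤ n) (hx : x ∈ grid S β n) (hrx : ‖β‖ ^ (-r) < ‖x‖) :
    propagator S β χ α v n ht x x ≤
      C * (Real.exp (-t * sphereInf v x) + t * (‖β‖ ^ r) ^ α) := by
  have hprob := (hχ.isPathMeasure_pathMeasure hβ hS hα ht.le hx).1
  rw [hχ.propagator_self_eq hβ hS hα ht v hx, ← le_inv_mul_iff₀ (pow_pos hS.card_pos n)]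
  exact integral_exp_neg_integral_le hv hv_nonneg ht fun s hs =>
    hχ.setIntegral_exp_neg_mul_eval_le hβ hS hα ht hv hv_nonneg hC hr hrn hx hrx hs

theorem IsRankZeroCharacter.propagator_self_le (hχ : IsRankZeroCharacter β χ)
    (hβ : IsUniformizer β) (hS : IsDigitSet S) (hα : 0 < α) (ht : 0 < t) (hv : Continuous v)
    (hv_nonneg : ∀ x, 0 ≤ v x) (hC : density S β χ α n (t / 2) 0 ≤ C) (hx : x ∈ grid S β n)
    (hx_ne : x ≠ 0) :
    propagator S β χ α v n ht x x ≤
      C * (Real.exp (-t * sphereInf v x) + t * ‖β‖ ^ (-α) * (1 / ‖x‖ ^ α)) := by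
  obtain ⟨j, hj⟩ := hβ.exists_norm_eq hx_ne
  have hle_iff (m : ℤ) : x ∈ ball β m ↔ j ≤ m := by
    rw [hβ.mem_ball_iff, hj, zpow_le_zpow_iff_right_of_lt_one₀ hβ.norm_pos hβ.norm_lt_one,
      neg_le_neg_iff]
  have hjn : j ≤ n := (hle_iff n).1 (hβ.mem_ball_of_mem_grid hS hx)
  have hnj : -(n : ℤ) < j := by
    refine not_le.1 fun h => hx_ne (hβ.eq_of_sub_mem_ball hS hx hS.zero_mem_grid ?_)
    rw [sub_zero]
    exact (hle_iff _).2 h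
  have hrx : ‖β‖ ^ (-(j - 1)) < ‖x‖ := by
    rw [hj]
    exact zpow_lt_zpow_right_of_lt_one₀ hβ.norm_pos hβ.norm_lt_one (by lia)
  have hpow : (‖β‖ ^ (j - 1)) ^ α = ‖β‖ ^ (-α) * (1 / ‖x‖ ^ α) := by
    have hinv : ‖β‖ ^ (j - 1) = ‖β‖⁻¹ * ‖x‖⁻¹ := by
      rw [hj, zpow_neg, inv_inv, zpow_sub_one₀ hβ.norm_pos.ne', mul_comm]
    rw [hinv, Real.mul_rpow (by positivity) (by positivity), Real.inv_rpow (norm_nonneg β),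
      Real.inv_rpow (norm_nonneg x), Real.rpow_neg (norm_nonneg β), one_div]
  rw [mul_assoc, ← hpow]
  exact hχ.propagator_self_le_of_zpow_lt_norm hβ hS hα ht hv hv_nonneg hC (by lia) (by lia) hx hrx

theorem IsRankZeroCharacter.exists_propagator_self_le (hχ : IsRankZeroCharacter β χ)
    (hβ : IsUniformizer β) (hS : IsDigitSet S) (hα : 0 < α) (ht : 0 < t) (hv : Continuous v)
    (hv_nonneg : ∀ x, 0 ≤ v x) :
    ∃ A : ℝ, 0 < A ∧ ∀ k : ℝ, 0 ≤ k → k ≤ α → ∀ n : ℕ, ∀ x ∈ grid S β n, x ≠ 0 →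
      propagator S β χ α v n ht x x ≤ A * (Real.exp (-t * sphereInf v x) + 1 / ‖x‖ ^ k) := by
  obtain ⟨C, hC⟩ := hβ.exists_density_zero_le hS χ hα (half_pos ht)
  have hC_pos : 0 < C := (density_zero_pos hS).trans_le (hC 0)
  have hβα : 0 < ‖β‖ ^ (-α) := Real.rpow_pos_of_pos hβ.norm_pos _
  refine ⟨C * (1 + t * ‖β‖ ^ (-α)), by positivity, fun k hk hkα n x hx hx_ne => ?_⟩
  have hx_pos : 0 < ‖x‖ := norm_pos_iff.2 hx_ne
  set e := Real.exp (-t * sphereInf v x)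
  have he : 0 < e := Real.exp_pos _
  rw [mul_assoc]
  rcases le_total ‖x‖ 1 with hle | hge
  · have hone : 1 ≤ 1 / ‖x‖ ^ k :=
      (one_le_div (by positivity)).2 (Real.rpow_le_one hx_pos.le hle hk)
    calc propagator S β χ α v n ht x x
      _ ≤ density S β χ α n t 0 := hχ.propagator_self_le_density hβ hS hα ht hv hv_nonneg hx
      _ ≤ C * (1 * 1) := by
        rw [mul_one, mul_one]
        exact (density_zero_antitone (half_le_self ht.le)).trans (hC n)
      _ ≤ C * ((1 + t * ‖β‖ ^ (-α)) * (e + 1 / ‖x‖ ^ k)) := by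
        gcongr
        · exact le_add_of_nonneg_right (by positivity)
        · exact le_add_of_nonneg_of_le he.le hone
  · calc propagator S β χ α v n ht x x
      _ ≤ C * (e + t * ‖β‖ ^ (-α) * (1 / ‖x‖ ^ α)) :=
        hχ.propagator_self_le hβ hS hα ht hv hv_nonneg (hC n) hx hx_ne
      _ ≤ C * (e + t * ‖β‖ ^ (-α) * (1 / ‖x‖ ^ k)) := by gcongr
      _ ≤ C * ((1 + t * ‖β‖ ^ (-α)) * (e + 1 / ‖x‖ ^ k)) := by
        gcongr
        have : 0 < 1 / ‖x‖ ^ k := by positivity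
        have : 0 < t * ‖β‖ ^ (-α) * e := by positivity
        linarith

end Estimate
end LocalFieldPropagator

end

open LocalFieldPropagator in
theorem mainTheorem9_general {K : Type*} [NontriviallyNormedField K] [IsUltrametricDist K]
    [MeasurableSpace K] [BorelSpace K] (β : K) (hβ : IsUniformizer β)
    (S : Finset K) (hS : IsDigitSet S) (χ : AddChar K Circle) (hχ : IsRankZeroCharacter β χ)
    (α : ℝ) (hα : 0 < α) (v : K → ℝ) (hv : Continuous v) (hv0 : ∀ x, 0 ≤ v x)
    (t : ℝ) (ht : 0 < t) :
    (∀ n : ℕ, ∀ a ∈ grid S β n,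
      ∃! P : MeasureTheory.Measure (SkorokhodSpace K t), IsPathMeasure S β χ α n t a P) ∧
    ∃ A : ℝ, 0 < A ∧ ∀ k : ℝ, 0 ≤ k → k ≤ α → ∀ n : ℕ, ∀ x ∈ grid S β n, x ≠ 0 →
      propagator S β χ α v n ht x x ≤
        A * (Real.exp (-t * sphereInf v x) + 1 / ‖x‖ ^ k) :=
  ⟨fun _ _ ha => hχ.existsUnique_isPathMeasure hβ hS hα ht.le ha,
    hχ.exists_propagator_self_le hβ hS hα ht hv hv0⟩

open LocalFieldPropagator in
theorem mainTheorem9 {K : Type*} [NontriviallyNormedField K] [IsUltrametricDist K]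
    [LocallyCompactSpace K] [MeasurableSpace K] [BorelSpace K]
    (hK : IsCanonicalAbs K)
    (β : K) (hβ : IsUniformizer β)
    (S : Finset K) (hS : IsDigitSet S)
    (χ : AddChar K Circle) (hχ : IsRankZeroCharacter β χ)
    (α : ℝ) (hα : 0 < α)
    (v : K → ℝ) (hv : Continuous v) (hv0 : ∀ x, 0 ≤ v x)
    (hvlim : Filter.Tendsto v (Bornology.cobounded K) Filter.atTop)
    (t : ℝ) (ht : 0 < t) :
    (∀ n : ℕ, 0 < n → ∀ a ∈ grid S β n,
      ∃! P : MeasureTheory.Measure (SkorokhodSpace K t), IsPathMeasure S β χ α n t a P) ∧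
    ∀ k : ℝ, 0 < k → k < α →
      ∃ A : ℝ, 0 < A ∧ ∀ n : ℕ, 0 < n → ∀ x ∈ grid S β n, x ≠ 0 →
        propagator S β χ α v n ht x x ≤
          A * (Real.exp (-(t / 2) * sphereInf v x) + 1 / ‖x‖ ^ k) := by
  obtain ⟨hexists, A, hA, hbound⟩ := mainTheorem9_general β hβ S hS χ hχ α hα v hv hv0 t ht
  refine ⟨fun n _ => hexists n, fun k hk hkα => ⟨A, hA, fun n _ x hx hx_ne => ?_⟩⟩
  refine (hbound k hk.le hkα.le n x hx hx_ne).trans ?_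
  have := sphereInf_nonneg hv0 x
  gcongr
  linarith
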